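/- **Setting.** A $W^*$-category is a category whose morphism spaces are complex Banach spaces with bilinear composition satisfying $\|f\circ g\|\le\|f\|\,\|g\|$, with isometric conjugate-linear involutions $^*:\mathrm{Hom}(X,Y)\to\mathrm{Hom}(Y,X)$ such that $(f\circ g)^*=g^*\circ f^*$ and $\|f^*f\|=\|f\|^2$, and such that every $\mathrm{Hom}(X,Y)$ is the dual of a Banach space $\mathrm{Hom}(X,Y)_*$. A linear map between morphism spaces is normal if it is continuous for the ultraweak topologies, i.e. the weak-$*$ topologies given by these preduals. A monoidal $W^*$-category is a $W^*$-category that is a monoidal category (not necessarily strict) whose tensor product is bilinear on morphisms, satisfies $(f\otimes g)^*=f^*\otimes g^*$ and is normal in each variable. It is concrete if it comes with a strong monoidal functor $\mathrm{For}:\mathcal C\to\mathrm{Hilb}$ to the category of Hilbert spaces and bounded operators (with the Hilbert space tensor product) that is linear, $^*$-preserving and normal on morphism spaces and has unitary coherence isomorphisms $\mathrm{For}(X)\otimes\mathrm{For}(Y)\cong\mathrm{For}(X\otimes Y)$; these are used to identify the two sides. We write $\mathcal H,\mathcal K,\mathcal L$ for the Hilbert spaces $\mathrm{For}(H),\mathrm{For}(K),\mathrm{For}(L)$.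 Let $B(\mathcal H,\mathcal K)_*$ be the space of normal functionals on $B(\mathcal H,\mathcal K)$, i.e. the norm closed linear span of the functionals $T\mapsto\langle\eta,T\xi\rangle$, and let $[S]$ denote the norm closed linear span of a set $S$ of bounded operators. For $T\in B(\mathcal H_1\otimes\mathcal K_1,\mathcal H_2\otimes\mathcal K_2)$ and $\omega\in B(\mathcal K_1,\mathcal K_2)_*$ let $(\mathrm{id}\otimes\omega)(T)\in B(\mathcal H_1,\mathcal H_2)$ be the right-leg slice, given by $\langle\eta,(\mathrm{id}\otimes\omega)(T)\xi\rangle=\omega\big((\langle\eta|\otimes\mathrm{id})\,T\,(|\xi\rangle\otimes\mathrm{id})\big)$. A braiding $c$ on $\mathcal C$ is called semi-regular if every $c_{H,K}:H\otimes K\to K\otimes H$ is unitary and, for all objects $H,K$, every compact operator from $\mathcal H$ to $\mathcal K$ lies in $[(\mathrm{id}\otimes\omega)(c_{H,K})\mid\omega\in B(\mathcal K,\mathcal H)_*]$. A multiplicative unitary is a unitary endomorphism $F$ in $\mathcal C$ of $L\otimes L$, for an object $L$, such that $$F_{23}F_{12}=F_{12}\,(c_{L,L}^{-1})_{12}\,F_{23}\,(c_{L,L})_{12}\,F_{23}$$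 on $L\otimes L\otimes L$ (with the associator inserted where needed), where $X_{12}=X\otimes\mathrm{id}_L$ and $X_{23}=\mathrm{id}_L\otimes X$. Put $$\hat A(F)=[(\mathrm{id}\otimes\omega)(F)\mid\omega\in B(\mathcal L)_*],\qquad C(F)=[(\mathrm{id}\otimes\omega)(c_{L,L}^{-1}F)\mid\omega\in B(\mathcal L)_*].$$ $F$ is called semi-regular if $C(F)$ contains all compact operators on $\mathcal L$. **Proposition.** Let $\mathcal C$ be a concrete monoidal $W^*$-category with a semi-regular braiding $c$, let $L\in\mathcal C$ be an object, and let $F\in\mathrm{End}_{\mathcal C}(L\otimes L)$ be a multiplicative unitary. If $C(F)=C(F)^*$, then $\hat A(F)\subseteq B(\mathcal L)$ is a $C^*$-algebra, i.e. a norm closed subspace that is closed under multiplication and under adjoints. If $F$ is semi-regular, then $C(F)=C(F)^*$, and so $\hat A(F)$ is a $C^*$-algebra. -/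

import Mathlib

open CategoryTheory MonoidalCategory
open scoped TensorProduct

universe w v u

noncomputable section

namespace BraidedMU

/-! ### Hilbert space tensor products -/

section HilbertTensor

variable {H K L M : Type*}
  [NormedAddCommGroup H] [InnerProductSpace ℂ H]
  [NormedAddCommGroup K] [InnerProductSpace ℂ K]
  [NormedAddCommGroup L] [InnerProductSpace ℂ L]
  [NormedAddCommGroup M] [InnerProductSpace ℂ M]

/-- The Hilbert space tensor product: the completion of the algebraic tensor product. -/
def HTensor (H K : Type*) [NormedAddCommGroup H] [InnerProductSpace ℂ H]
    [NormedAddCommGroup K] [InnerProductSpace ℂ K] : Type _ :=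
  UniformSpace.Completion (H ⊗[ℂ] K)

instance : NormedAddCommGroup (HTensor H K) :=
  inferInstanceAs (NormedAddCommGroup (UniformSpace.Completion (H ⊗[ℂ] K)))

instance : InnerProductSpace ℂ (HTensor H K) :=
  inferInstanceAs (InnerProductSpace ℂ (UniformSpace.Completion (H ⊗[ℂ] K)))

instance : CompleteSpace (HTensor H K) :=
  inferInstanceAs (CompleteSpace (UniformSpace.Completion (H ⊗[ℂ] K)))

/-- The inclusion of the algebraic tensor product. -/
def algIncl (H K : Type*) [NormedAddCommGroup H] [InnerProductSpace ℂ H]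
    [NormedAddCommGroup K] [InnerProductSpace ℂ K] : H ⊗[ℂ] K →ₗᵢ[ℂ] HTensor H K :=
  (UniformSpace.Completion.toComplₗᵢ : H ⊗[ℂ] K →ₗᵢ[ℂ] UniformSpace.Completion (H ⊗[ℂ] K))

theorem algIncl_denseRange : DenseRange (algIncl H K) :=
  UniformSpace.Completion.denseRange_coe (α := H ⊗[ℂ] K)

/-- The bounded bilinear map `(ξ, η) ↦ ξ ⊗ η`. For fixed `ξ` it is the operator
`|ξ⟩ ⊗ id : K → H ⊗ K`. -/
def tmulL (H K : Type*) [NormedAddCommGroup H] [InnerProductSpace ℂ H]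
    [NormedAddCommGroup K] [InnerProductSpace ℂ K] : H →L[ℂ] K →L[ℂ] HTensor H K :=
  (ContinuousLinearMap.compL ℂ K (H ⊗[ℂ] K) (HTensor H K)
    (algIncl H K).toContinuousLinearMap).comp (TensorProduct.mkL ℂ H K)

theorem tmulL_apply (ξ : H) (η : K) : tmulL H K ξ η = algIncl H K (ξ ⊗ₜ[ℂ] η) := rfl

theorem inner_tmulL (ξ ξ' : H) (η η' : K) :
    inner ℂ (tmulL H K ξ η) (tmulL H K ξ' η') = inner ℂ ξ ξ' * inner ℂ η η' := by
  simp [tmulL_apply, LinearIsometry.inner_map_map]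

theorem norm_tmulL (ξ : H) (η : K) : ‖tmulL H K ξ η‖ = ‖ξ‖ * ‖η‖ := by
  simp [tmulL_apply]

theorem mem_of_tmulL_mem (S : Submodule ℂ (HTensor H K))
    (hS : IsClosed (S : Set (HTensor H K))) (h : ∀ ξ η, tmulL H K ξ η ∈ S)
    (x : HTensor H K) : x ∈ S := by
  refine algIncl_denseRange.induction_on (p := fun x => x ∈ S) x hS fun a => ?_
  induction a using TensorProduct.induction_on with
  | zero => simp
  | tmul x y => exact h x y
  | add x y hx hy => rw [map_add]; exact S.add_mem hx hy

/-- Bounded operators on `H ⊗ K` are determined by elementary tensors. -/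
theorem hTensor_ext {f g : HTensor H K →L[ℂ] L}
    (h : ∀ ξ η, f (tmulL H K ξ η) = g (tmulL H K ξ η)) : f = g :=
  ContinuousLinearMap.ext fun x =>
    mem_of_tmulL_mem (LinearMap.eqLocus f.toLinearMap g.toLinearMap)
      (isClosed_eq f.continuous g.continuous) h x

theorem hTensor_ext₃ {f g : HTensor (HTensor H K) L →L[ℂ] M}
    (h : ∀ ξ η ζ, f (tmulL _ L (tmulL H K ξ η) ζ) = g (tmulL _ L (tmulL H K ξ η) ζ)) :
    f = g := by
  refine hTensor_ext fun z l => ?_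
  have := hTensor_ext (f := f.comp ((tmulL (HTensor H K) L).flip l))
    (g := g.comp ((tmulL (HTensor H K) L).flip l)) (fun ξ η => h ξ η l)
  exact congrArg (fun T => T z) this

/-- The tensor product `f ⊗ g` of bounded operators. -/
def hMap (f : H →L[ℂ] K) (g : L →L[ℂ] M) : HTensor H L →L[ℂ] HTensor K M :=
  (TensorProduct.mapL f g).completion

@[simp] theorem hMap_tmulL (f : H →L[ℂ] K) (g : L →L[ℂ] M) (ξ : H) (η : L) :
    hMap f g (tmulL H L ξ η) = tmulL K M (f ξ) (g η) :=
  (TensorProduct.mapL f g).completion_apply_coe (ξ ⊗ₜ η)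

/-- The algebraic triple tensor product inside `(H ⊗ K) ⊗ L`. -/
def tripleL (H K L : Type*) [NormedAddCommGroup H] [InnerProductSpace ℂ H]
    [NormedAddCommGroup K] [InnerProductSpace ℂ K] [NormedAddCommGroup L]
    [InnerProductSpace ℂ L] : (H ⊗[ℂ] K) ⊗[ℂ] L →ₗᵢ[ℂ] HTensor (HTensor H K) L :=
  (algIncl (HTensor H K) L).comp (LinearIsometry.rTensor L (algIncl H K))

/-- The algebraic triple tensor product inside `H ⊗ (K ⊗ L)`. -/
def tripleR (H K L : Type*) [NormedAddCommGroup H] [InnerProductSpace ℂ H]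
    [NormedAddCommGroup K] [InnerProductSpace ℂ K] [NormedAddCommGroup L]
    [InnerProductSpace ℂ L] : H ⊗[ℂ] (K ⊗[ℂ] L) →ₗᵢ[ℂ] HTensor H (HTensor K L) :=
  (algIncl H (HTensor K L)).comp (LinearIsometry.lTensor H (algIncl K L))

theorem tripleL_denseRange : DenseRange (tripleL H K L).toLinearMap := by
  intro x
  have h := mem_of_tmulL_mem (LinearMap.range (tripleL H K L).toLinearMap).topologicalClosure
    (Submodule.isClosed_topologicalClosure _) ?_ x
  · rwa [← SetLike.mem_coe, Submodule.topologicalClosure_coe, LinearMap.coe_range] at h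
  · intro z l
    refine mem_of_tmulL_mem (Submodule.comap ((tmulL (HTensor H K) L).flip l).toLinearMap
      (LinearMap.range (tripleL H K L).toLinearMap).topologicalClosure) ?_ ?_ z
    · exact (Submodule.isClosed_topologicalClosure _).preimage
        ((tmulL (HTensor H K) L).flip l).continuous
    · intro ξ η
      exact Submodule.le_topologicalClosure _ ⟨(ξ ⊗ₜ η) ⊗ₜ l, rfl⟩

theorem tripleR_denseRange : DenseRange (tripleR H K L).toLinearMap := by
  intro x
  have h := mem_of_tmulL_mem (LinearMap.range (tripleR H K L).toLinearMap).topologicalClosure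
    (Submodule.isClosed_topologicalClosure _) ?_ x
  · rwa [← SetLike.mem_coe, Submodule.topologicalClosure_coe, LinearMap.coe_range] at h
  · intro l z
    refine mem_of_tmulL_mem (Submodule.comap (tmulL H (HTensor K L) l).toLinearMap
      (LinearMap.range (tripleR H K L).toLinearMap).topologicalClosure) ?_ ?_ z
    · exact (Submodule.isClosed_topologicalClosure _).preimage
        (tmulL H (HTensor K L) l).continuous
    · intro ξ η
      exact Submodule.le_topologicalClosure _ ⟨l ⊗ₜ (ξ ⊗ₜ η), rfl⟩

/-- The associator `(H ⊗ K) ⊗ L ≃ H ⊗ (K ⊗ L)`. -/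
def hAssoc (H K L : Type*) [NormedAddCommGroup H] [InnerProductSpace ℂ H]
    [NormedAddCommGroup K] [InnerProductSpace ℂ K] [NormedAddCommGroup L]
    [InnerProductSpace ℂ L] :
    HTensor (HTensor H K) L ≃ₗᵢ[ℂ] HTensor H (HTensor K L) :=
  (TensorProduct.assoc ℂ H K L).extendOfIsometry (tripleL H K L).toLinearMap
    (tripleR H K L).toLinearMap tripleL_denseRange tripleR_denseRange (fun x => by
      simp only [LinearIsometry.coe_toLinearMap, LinearIsometry.norm_map,
        TensorProduct.norm_assoc])

@[simp] theorem hAssoc_tmulL (ξ : H) (η : K) (ζ : L) :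
    hAssoc H K L (tmulL (HTensor H K) L (tmulL H K ξ η) ζ) =
      tmulL H (HTensor K L) ξ (tmulL K L η ζ) :=
  LinearEquiv.extendOfIsometry_eq (f := TensorProduct.assoc ℂ H K L)
    (e₁ := (tripleL H K L).toLinearMap) (e₂ := (tripleR H K L).toLinearMap)
    tripleL_denseRange tripleR_denseRange _ ((ξ ⊗ₜ η) ⊗ₜ ζ)

instance uliftInnerProductSpace : InnerProductSpace ℂ (ULift ℂ) where
  inner x y := inner ℂ x.down y.down
  norm_sq_eq_re_inner x := norm_sq_eq_re_inner (𝕜 := ℂ) x.down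
  conj_inner_symm x y := inner_conj_symm (𝕜 := ℂ) x.down y.down
  add_left x y z := inner_add_left (𝕜 := ℂ) x.down y.down z.down
  smul_left x y c := inner_smul_left (𝕜 := ℂ) x.down y.down c

/-- `ℂ`, lifted to an arbitrary universe. -/
def uliftIso : ULift ℂ ≃ₗᵢ[ℂ] ℂ where
  toLinearEquiv := ULift.moduleEquiv
  norm_map' _ := rfl

/-- The left unitor `ℂ ⊗ H ≃ H`. -/
def hLeftUnitor (H : Type*) [NormedAddCommGroup H] [InnerProductSpace ℂ H] [CompleteSpace H] :
    HTensor (ULift ℂ) H ≃ₗᵢ[ℂ] H :=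
  ((TensorProduct.congrIsometry uliftIso (LinearIsometryEquiv.refl ℂ H)).trans
      (TensorProduct.lidIsometry ℂ H)).toLinearEquiv.extendOfIsometry
    (algIncl (ULift ℂ) H).toLinearMap LinearMap.id algIncl_denseRange
    Function.surjective_id.denseRange (fun x => by
      simp only [LinearIsometry.coe_toLinearMap, LinearIsometry.norm_map, LinearMap.id_apply]
      exact LinearIsometryEquiv.norm_map _ x)

@[simp] theorem hLeftUnitor_tmulL [CompleteSpace H] (z : ULift ℂ) (ξ : H) :
    hLeftUnitor H (tmulL (ULift ℂ) H z ξ) = z.down • ξ :=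
  LinearEquiv.extendOfIsometry_eq _ _ (LinearMap.id : H →ₗ[ℂ] H) algIncl_denseRange
    Function.surjective_id.denseRange _ (z ⊗ₜ ξ)

/-- The right unitor `H ⊗ ℂ ≃ H`. -/
def hRightUnitor (H : Type*) [NormedAddCommGroup H] [InnerProductSpace ℂ H] [CompleteSpace H] :
    HTensor H (ULift ℂ) ≃ₗᵢ[ℂ] H :=
  ((TensorProduct.congrIsometry (LinearIsometryEquiv.refl ℂ H) uliftIso).trans
      (TensorProduct.ridIsometry ℂ H)).toLinearEquiv.extendOfIsometry
    (algIncl H (ULift ℂ)).toLinearMap LinearMap.id algIncl_denseRange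
    Function.surjective_id.denseRange (fun x => by
      simp only [LinearIsometry.coe_toLinearMap, LinearIsometry.norm_map, LinearMap.id_apply]
      exact LinearIsometryEquiv.norm_map _ x)

@[simp] theorem hRightUnitor_tmulL [CompleteSpace H] (z : ULift ℂ) (ξ : H) :
    hRightUnitor H (tmulL H (ULift ℂ) ξ z) = z.down • ξ :=
  LinearEquiv.extendOfIsometry_eq _ _ (LinearMap.id : H →ₗ[ℂ] H) algIncl_denseRange
    Function.surjective_id.denseRange _ (ξ ⊗ₜ z)

end HilbertTensor

/-! ### The monoidal category of Hilbert spaces -/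

/-- Complex Hilbert spaces. -/
structure HilbCat : Type (w + 1) where
  carrier : Type w
  [normedAddCommGroup : NormedAddCommGroup carrier]
  [innerProductSpace : InnerProductSpace ℂ carrier]
  [completeSpace : CompleteSpace carrier]

namespace HilbCat

instance : CoeSort HilbCat.{w} (Type w) := ⟨carrier⟩

attribute [instance] normedAddCommGroup innerProductSpace completeSpace

/-- Morphisms of Hilbert spaces are the bounded linear operators. -/
instance : Category HilbCat.{w} where
  Hom H K := H →L[ℂ] K
  id H := ContinuousLinearMap.id ℂ H
  comp f g := ContinuousLinearMap.comp g f

/-- The bounded operator underlying a morphism. -/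
def toCLM {H K : HilbCat.{w}} (f : H ⟶ K) : H →L[ℂ] K := f

/-- A unitary operator as an isomorphism. -/
def isoOfUnitary {H K : HilbCat.{w}} (e : H ≃ₗᵢ[ℂ] K) : H ≅ K where
  hom := e.toContinuousLinearEquiv.toContinuousLinearMap
  inv := e.symm.toContinuousLinearEquiv.toContinuousLinearMap
  hom_inv_id := ContinuousLinearMap.ext fun x => e.symm_apply_apply x
  inv_hom_id := ContinuousLinearMap.ext fun x => e.apply_symm_apply x

instance : MonoidalCategoryStruct HilbCat.{w} where
  tensorObj H K := ⟨HTensor H K⟩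
  whiskerLeft H _ _ f := hMap (ContinuousLinearMap.id ℂ H) f
  whiskerRight f K := hMap f (ContinuousLinearMap.id ℂ K)
  tensorHom f g := hMap f g
  tensorUnit := ⟨ULift.{w} ℂ⟩
  associator H K L := isoOfUnitary (hAssoc H K L)
  leftUnitor H := isoOfUnitary (hLeftUnitor H)
  rightUnitor H := isoOfUnitary (hRightUnitor H)

instance : MonoidalCategory HilbCat.{w} :=
  MonoidalCategory.ofTensorHom
    (id_tensorHom_id := fun H K => hTensor_ext fun ξ η => hMap_tmulL _ _ ξ η)
    (id_tensorHom := fun _ _ _ _ => rfl)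
    (tensorHom_id := fun _ _ => rfl)
    (tensorHom_comp_tensorHom := fun f₁ f₂ g₁ g₂ => hTensor_ext fun ξ η => by
      change hMap g₁ g₂ (hMap f₁ f₂ (tmulL _ _ ξ η)) =
        hMap (g₁.comp f₁) (g₂.comp f₂) (tmulL _ _ ξ η)
      rw [hMap_tmulL, hMap_tmulL, hMap_tmulL]; rfl)
    (associator_naturality := fun {X₁ X₂ X₃ Y₁ Y₂ Y₃} f₁ f₂ f₃ => hTensor_ext₃ fun ξ η ζ => by
      change hAssoc Y₁ Y₂ Y₃ (hMap (hMap f₁ f₂) f₃ (tmulL _ _ (tmulL _ _ ξ η) ζ)) =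
        hMap f₁ (hMap f₂ f₃) (hAssoc X₁ X₂ X₃ (tmulL _ _ (tmulL _ _ ξ η) ζ))
      rw [hMap_tmulL, hMap_tmulL, hAssoc_tmulL, hAssoc_tmulL, hMap_tmulL, hMap_tmulL])
    (leftUnitor_naturality := fun {X Y} f => hTensor_ext fun (z : ULift.{w} ℂ) ξ => by
      change hLeftUnitor Y (hMap (ContinuousLinearMap.id ℂ (ULift ℂ)) f (tmulL _ _ z ξ)) =
        toCLM f (hLeftUnitor X (tmulL _ _ z ξ))
      rw [hMap_tmulL, hLeftUnitor_tmulL, hLeftUnitor_tmulL, map_smul]; rfl)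
    (rightUnitor_naturality := fun {X Y} f => hTensor_ext fun ξ (z : ULift.{w} ℂ) => by
      change hRightUnitor Y (hMap f (ContinuousLinearMap.id ℂ (ULift ℂ)) (tmulL _ _ ξ z)) =
        toCLM f (hRightUnitor X (tmulL _ _ ξ z))
      rw [hMap_tmulL, hRightUnitor_tmulL, hRightUnitor_tmulL, map_smul]; rfl)
    (pentagon := fun W X Y Z => hTensor_ext fun t ζ => by
      have key := hTensor_ext₃ (H := W) (K := X) (L := Y)
        (f := ((hMap (ContinuousLinearMap.id ℂ W)
            (hAssoc X Y Z).toContinuousLinearEquiv.toContinuousLinearMap).comp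
          ((hAssoc W (HTensor X Y) Z).toContinuousLinearEquiv.toContinuousLinearMap.comp
          (hMap (hAssoc W X Y).toContinuousLinearEquiv.toContinuousLinearMap
            (ContinuousLinearMap.id ℂ Z)))).comp
            ((tmulL (HTensor (HTensor W X) Y) Z).flip ζ))
        (g := ((hAssoc W X (HTensor Y Z)).toContinuousLinearEquiv.toContinuousLinearMap.comp
          (hAssoc (HTensor W X) Y Z).toContinuousLinearEquiv.toContinuousLinearMap).comp
            ((tmulL (HTensor (HTensor W X) Y) Z).flip ζ))
        (fun ω ξ η => by simp)
      exact congrArg (fun T => T t) key)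
    (triangle := fun X Y => hTensor_ext₃ fun ξ (z : ULift.{w} ℂ) η => by
      change hMap (ContinuousLinearMap.id ℂ X)
          (hLeftUnitor Y).toContinuousLinearEquiv.toContinuousLinearMap
          (hAssoc X (ULift ℂ) Y (tmulL _ _ (tmulL _ _ ξ z) η)) =
        hMap (hRightUnitor X).toContinuousLinearEquiv.toContinuousLinearMap
          (ContinuousLinearMap.id ℂ Y) (tmulL _ _ (tmulL _ _ ξ z) η)
      rw [hAssoc_tmulL, hMap_tmulL, hMap_tmulL]
      simp)

end HilbCat

/-! ### Normal functionals and slices -/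

set_option linter.unusedSectionVars false

section Normal

variable {H K H₁ H₂ K₁ K₂ : Type*}
  [NormedAddCommGroup H] [InnerProductSpace ℂ H]
  [NormedAddCommGroup K] [InnerProductSpace ℂ K]
  [NormedAddCommGroup H₁] [InnerProductSpace ℂ H₁] [CompleteSpace H₁]
  [NormedAddCommGroup H₂] [InnerProductSpace ℂ H₂] [CompleteSpace H₂]
  [NormedAddCommGroup K₁] [InnerProductSpace ℂ K₁] [CompleteSpace K₁]
  [NormedAddCommGroup K₂] [InnerProductSpace ℂ K₂] [CompleteSpace K₂]

/-- The vector functional `T ↦ ⟨η, T ξ⟩`. -/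
def vectorFunctional (η : K) (ξ : H) : StrongDual ℂ (H →L[ℂ] K) :=
  (innerSL ℂ η).comp (ContinuousLinearMap.apply ℂ K ξ)

@[simp] theorem vectorFunctional_apply (η : K) (ξ : H) (T : H →L[ℂ] K) :
    vectorFunctional η ξ T = inner ℂ η (T ξ) := rfl

theorem norm_vectorFunctional_le (η : K) (ξ : H) : ‖vectorFunctional η ξ‖ ≤ ‖η‖ * ‖ξ‖ := by
  refine ContinuousLinearMap.opNorm_le_bound _ (by positivity) fun T => ?_
  calc ‖inner ℂ η (T ξ)‖ ≤ ‖η‖ * ‖T ξ‖ := norm_inner_le_norm _ _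
    _ ≤ ‖η‖ * (‖T‖ * ‖ξ‖) := by gcongr; exact T.le_opNorm ξ
    _ = ‖η‖ * ‖ξ‖ * ‖T‖ := by ring

/-- The Banach space dual of `B(H, K)`. -/
def OpDual (H K : Type*) [NormedAddCommGroup H] [InnerProductSpace ℂ H]
    [NormedAddCommGroup K] [InnerProductSpace ℂ K] : Type _ := StrongDual ℂ (H →L[ℂ] K)

instance : NormedAddCommGroup (OpDual H K) :=
  inferInstanceAs (NormedAddCommGroup (StrongDual ℂ (H →L[ℂ] K)))

instance : NormedSpace ℂ (OpDual H K) :=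
  inferInstanceAs (NormedSpace ℂ (StrongDual ℂ (H →L[ℂ] K)))

instance : CompleteSpace (OpDual H K) :=
  inferInstanceAs (CompleteSpace (StrongDual ℂ (H →L[ℂ] K)))

/-- The vector functionals span this subspace of the dual of `B(H, K)`. -/
def vectorSpan (H K : Type*) [NormedAddCommGroup H] [InnerProductSpace ℂ H]
    [NormedAddCommGroup K] [InnerProductSpace ℂ K] : Submodule ℂ (OpDual H K) :=
  Submodule.span ℂ (Set.range fun p : K × H => vectorFunctional p.1 p.2)

/-- The predual `B(H, K)_*`, i.e. the Banach space of normal functionals on `B(H, K)`: the norm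
closed linear span of the vector functionals. -/
abbrev NormalFunctional (H K : Type*) [NormedAddCommGroup H] [InnerProductSpace ℂ H]
    [NormedAddCommGroup K] [InnerProductSpace ℂ K] : Type _ :=
  (vectorSpan H K).topologicalClosure

instance : CompleteSpace (NormalFunctional H K) :=
  (Submodule.isClosed_topologicalClosure _).completeSpace_coe

/-- The inclusion of the predual into the dual of `B(H, K)`. -/
def NormalFunctional.incl (H K : Type*) [NormedAddCommGroup H] [InnerProductSpace ℂ H]
    [NormedAddCommGroup K] [InnerProductSpace ℂ K] :
    NormalFunctional H K →ₗᵢ[ℂ] StrongDual ℂ (H →L[ℂ] K) where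
  toFun ω := ω.1
  map_add' _ _ := rfl
  map_smul' _ _ := rfl
  norm_map' _ := rfl

/-- A vector functional as an element of the predual. -/
def NormalFunctional.vector (η : K) (ξ : H) : NormalFunctional H K :=
  ⟨vectorFunctional η ξ, Submodule.le_topologicalClosure _ (Submodule.subset_span ⟨(η, ξ), rfl⟩)⟩

theorem NormalFunctional.ext {ω ω' : NormalFunctional H K}
    (h : ∀ T, NormalFunctional.incl H K ω T = NormalFunctional.incl H K ω' T) : ω = ω' :=
  (NormalFunctional.incl H K).injective (ContinuousLinearMap.ext h)

theorem NormalFunctional.incl_vector (η : K) (ξ : H) (T : H →L[ℂ] K) :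
    NormalFunctional.incl H K (NormalFunctional.vector η ξ) T = inner ℂ η (T ξ) := rfl

theorem NormalFunctional.norm_vector_le (η : K) (ξ : H) :
    ‖NormalFunctional.vector η ξ‖ ≤ ‖η‖ * ‖ξ‖ :=
  norm_vectorFunctional_le η ξ

theorem NormalFunctional.dual_ext {φ ψ : StrongDual ℂ (NormalFunctional H K)}
    (h : ∀ η ξ, φ (NormalFunctional.vector η ξ) = ψ (NormalFunctional.vector η ξ)) : φ = ψ := by
  have hle : vectorSpan H K ≤ (LinearMap.ker (φ - ψ).toLinearMap).map
      (vectorSpan H K).topologicalClosure.subtype := by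
    refine Submodule.span_le.2 ?_
    rintro _ ⟨p, rfl⟩
    refine ⟨NormalFunctional.vector p.1 p.2, ?_, rfl⟩
    simp [h p.1 p.2]
  have hker : IsClosed ((LinearMap.ker (φ - ψ).toLinearMap :
      Submodule ℂ (NormalFunctional H K)) : Set (NormalFunctional H K)) :=
    (φ - ψ).isClosed_ker
  have hcl : IsClosed (((LinearMap.ker (φ - ψ).toLinearMap).map
      (vectorSpan H K).topologicalClosure.subtype : Submodule ℂ (OpDual H K)) :
        Set (OpDual H K)) :=
    (Submodule.isClosed_topologicalClosure (vectorSpan H K)).isClosedEmbedding_subtypeVal.isClosedMap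
      _ hker
  refine ContinuousLinearMap.ext fun ω => ?_
  obtain ⟨ω', h1, h2⟩ := Submodule.topologicalClosure_minimal _ hle hcl ω.2
  obtain rfl : ω' = ω := Subtype.ext h2
  simpa [sub_eq_zero] using h1

/-- The canonical map from `B(H, K)` to the dual of its predual. -/
def predualEval (H K : Type*) [NormedAddCommGroup H] [InnerProductSpace ℂ H]
    [NormedAddCommGroup K] [InnerProductSpace ℂ K] :
    (H →L[ℂ] K) →ₗᵢ[ℂ] StrongDual ℂ (NormalFunctional H K) where
  toFun T := (NormedSpace.inclusionInDoubleDual ℂ (H →L[ℂ] K) T).comp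
    (NormalFunctional.incl H K).toContinuousLinearMap
  map_add' S T := by ext ω; simp
  map_smul' c T := by ext ω; simp
  norm_map' T := by
    change ‖(NormedSpace.inclusionInDoubleDual ℂ (H →L[ℂ] K) T).comp
      (NormalFunctional.incl H K).toContinuousLinearMap‖ = ‖T‖
    set φ : StrongDual ℂ (NormalFunctional H K) :=
      (NormedSpace.inclusionInDoubleDual ℂ (H →L[ℂ] K) T).comp
        (NormalFunctional.incl H K).toContinuousLinearMap with hφ
    have hval : ∀ ω, φ ω = NormalFunctional.incl H K ω T := fun _ => rfl
    refine le_antisymm (ContinuousLinearMap.opNorm_le_bound φ (norm_nonneg T) fun ω => ?_)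
      (ContinuousLinearMap.opNorm_le_bound T (norm_nonneg φ) fun ξ => ?_)
    · calc ‖φ ω‖ ≤ ‖NormalFunctional.incl H K ω‖ * ‖T‖ := by
            rw [hval]; exact ContinuousLinearMap.le_opNorm _ _
        _ = ‖T‖ * ‖ω‖ := by rw [LinearIsometry.norm_map, mul_comm]
    · have h2 := φ.le_opNorm (NormalFunctional.vector (T ξ) ξ)
      rw [hval, NormalFunctional.incl_vector, inner_self_eq_norm_sq_to_K] at h2
      have h3 := mul_le_mul_of_nonneg_left (NormalFunctional.norm_vector_le (T ξ) ξ)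
        (norm_nonneg φ)
      simp only [norm_pow, RCLike.norm_ofReal, abs_norm] at h2
      rcases (norm_nonneg (T ξ)).eq_or_lt with h0 | h0
      · rw [← h0]; positivity
      · nlinarith

theorem predualEval_apply (T : H →L[ℂ] K) (ω : NormalFunctional H K) :
    predualEval H K T ω = NormalFunctional.incl H K ω T := rfl

/-- The operator defined by a bounded sesquilinear form `(η, ξ) ↦ a η ξ`, given through
its conjugate `b ξ η`. -/
def ofConjForm (b : H₁ →L⋆[ℂ] StrongDual ℂ H₂) : H₁ →L[ℂ] H₂ :=
  ((InnerProductSpace.toDual ℂ H₂).symm.toContinuousLinearEquiv.toContinuousLinearMap :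
    StrongDual ℂ H₂ →L⋆[ℂ] H₂).comp b

theorem inner_ofConjForm (b : H₁ →L⋆[ℂ] StrongDual ℂ H₂) (η : H₂) (ξ : H₁) :
    inner ℂ η (ofConjForm b ξ) = (starRingEnd ℂ) (b ξ η) := by
  rw [← inner_conj_symm]
  congr 1
  exact InnerProductSpace.toDual_symm_apply

theorem predualEval_surjective : Function.Surjective (predualEval H₁ H₂) := by
  intro φ
  let b : H₁ →L⋆[ℂ] StrongDual ℂ H₂ := LinearMap.mkContinuous₂
    (LinearMap.mk₂'ₛₗ (starRingEnd ℂ) (RingHom.id ℂ)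
      (fun (ξ : H₁) (η : H₂) => (starRingEnd ℂ) (φ (NormalFunctional.vector η ξ)))
      (fun ξ ξ' η => by
        rw [← map_add, ← map_add]; congr 2
        exact NormalFunctional.ext fun T => by
          simp [NormalFunctional.incl_vector])
      (fun c ξ η => by
        rw [smul_eq_mul, ← map_mul, ← smul_eq_mul, ← map_smul]; congr 2
        exact NormalFunctional.ext fun T => by
          simp [NormalFunctional.incl_vector])
      (fun ξ η η' => by
        rw [← map_add, ← map_add]; congr 2
        exact NormalFunctional.ext fun T => by
          simp [NormalFunctional.incl_vector])
      (fun c ξ η => by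
        rw [← RCLike.conj_conj (RingHom.id ℂ c), smul_eq_mul, ← map_mul, ← smul_eq_mul,
          ← map_smul]; congr 2
        exact NormalFunctional.ext fun T => by
          simp [NormalFunctional.incl_vector, mul_comm]))
    ‖φ‖ (fun ξ η => by
      rw [LinearMap.mk₂'ₛₗ_apply, RCLike.norm_conj]
      calc _ ≤ ‖φ‖ * ‖NormalFunctional.vector η ξ‖ := φ.le_opNorm _
        _ ≤ ‖φ‖ * (‖η‖ * ‖ξ‖) := by gcongr; exact NormalFunctional.norm_vector_le η ξ
        _ = _ := by ring)
  refine ⟨ofConjForm b, NormalFunctional.dual_ext fun η ξ => ?_⟩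
  rw [predualEval_apply, NormalFunctional.incl_vector, inner_ofConjForm]
  exact RCLike.conj_conj _

/-- `B(H, K)` is the dual of `B(H, K)_*`. -/
def predualEquiv (H₁ H₂ : Type*) [NormedAddCommGroup H₁] [InnerProductSpace ℂ H₁]
    [CompleteSpace H₁] [NormedAddCommGroup H₂] [InnerProductSpace ℂ H₂] [CompleteSpace H₂] :
    (H₁ →L[ℂ] H₂) ≃ₗᵢ[ℂ] StrongDual ℂ (NormalFunctional H₁ H₂) :=
  LinearIsometryEquiv.ofSurjective (predualEval H₁ H₂) predualEval_surjective

/-- The matrix coefficient `(⟨η| ⊗ id) T (|ξ⟩ ⊗ id)` of `T : H₁ ⊗ K₁ → H₂ ⊗ K₂`. -/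
def matrixCoeff (T : HTensor H₁ K₁ →L[ℂ] HTensor H₂ K₂) (η : H₂) (ξ : H₁) : K₁ →L[ℂ] K₂ :=
  (ContinuousLinearMap.adjoint (tmulL H₂ K₂ η)).comp (T.comp (tmulL H₁ K₁ ξ))

theorem matrixCoeff_add_right (T : HTensor H₁ K₁ →L[ℂ] HTensor H₂ K₂) (η : H₂) (ξ ξ' : H₁) :
    matrixCoeff T η (ξ + ξ') = matrixCoeff T η ξ + matrixCoeff T η ξ' := by
  simp only [matrixCoeff, map_add, ContinuousLinearMap.comp_add]

theorem matrixCoeff_smul_right (T : HTensor H₁ K₁ →L[ℂ] HTensor H₂ K₂) (η : H₂) (c : ℂ)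
    (ξ : H₁) : matrixCoeff T η (c • ξ) = c • matrixCoeff T η ξ := by
  simp only [matrixCoeff, map_smul, ContinuousLinearMap.comp_smul]

theorem matrixCoeff_add_left (T : HTensor H₁ K₁ →L[ℂ] HTensor H₂ K₂) (η η' : H₂) (ξ : H₁) :
    matrixCoeff T (η + η') ξ = matrixCoeff T η ξ + matrixCoeff T η' ξ := by
  simp only [matrixCoeff, map_add, ContinuousLinearMap.add_comp]

theorem matrixCoeff_smul_left (T : HTensor H₁ K₁ →L[ℂ] HTensor H₂ K₂) (η : H₂) (c : ℂ)
    (ξ : H₁) : matrixCoeff T (c • η) ξ = (starRingEnd ℂ) c • matrixCoeff T η ξ := by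
  simp only [matrixCoeff, map_smul, LinearIsometryEquiv.map_smulₛₗ,
    ContinuousLinearMap.smul_comp]

theorem norm_tmulL_le (ξ : H) : ‖tmulL H K ξ‖ ≤ ‖ξ‖ :=
  ContinuousLinearMap.opNorm_le_bound _ (norm_nonneg ξ) fun k => (norm_tmulL ξ k).le

theorem norm_matrixCoeff_le (T : HTensor H₁ K₁ →L[ℂ] HTensor H₂ K₂) (η : H₂) (ξ : H₁) :
    ‖matrixCoeff T η ξ‖ ≤ ‖T‖ * ‖ξ‖ * ‖η‖ := by
  calc ‖matrixCoeff T η ξ‖ ≤ ‖ContinuousLinearMap.adjoint (tmulL H₂ K₂ η)‖ *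
        ‖T.comp (tmulL H₁ K₁ ξ)‖ := ContinuousLinearMap.opNorm_comp_le _ _
    _ ≤ ‖η‖ * (‖T‖ * ‖ξ‖) := by
      rw [LinearIsometryEquiv.norm_map]
      gcongr
      · exact norm_tmulL_le η
      · exact (ContinuousLinearMap.opNorm_comp_le _ _).trans (by gcongr; exact norm_tmulL_le ξ)
    _ = _ := by ring

/-- The right-leg slice `(id ⊗ ω)(T) : H₁ → H₂` of `T : H₁ ⊗ K₁ → H₂ ⊗ K₂`, which is
characterised by `inner_slice`. -/
def slice (T : HTensor H₁ K₁ →L[ℂ] HTensor H₂ K₂) (ω : NormalFunctional K₁ K₂) :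
    H₁ →L[ℂ] H₂ :=
  ofConjForm (LinearMap.mkContinuous₂
    (LinearMap.mk₂'ₛₗ (starRingEnd ℂ) (RingHom.id ℂ)
      (fun (ξ : H₁) (η : H₂) => (starRingEnd ℂ) (NormalFunctional.incl K₁ K₂ ω (matrixCoeff T η ξ)))
      (fun ξ ξ' η => by rw [matrixCoeff_add_right, map_add, map_add])
      (fun c ξ η => by rw [matrixCoeff_smul_right, map_smul, smul_eq_mul, map_mul, smul_eq_mul])
      (fun ξ η η' => by rw [matrixCoeff_add_left, map_add, map_add])
      (fun c ξ η => by
        rw [matrixCoeff_smul_left, map_smul, smul_eq_mul, map_mul, RCLike.conj_conj]; rfl))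
    (‖ω‖ * ‖T‖) (fun ξ η => by
      rw [LinearMap.mk₂'ₛₗ_apply, RCLike.norm_conj]
      calc _ ≤ ‖NormalFunctional.incl K₁ K₂ ω‖ * ‖matrixCoeff T η ξ‖ :=
            ContinuousLinearMap.le_opNorm _ _
        _ ≤ ‖ω‖ * (‖T‖ * ‖ξ‖ * ‖η‖) := by
            rw [LinearIsometry.norm_map]; gcongr; exact norm_matrixCoeff_le T η ξ
        _ = _ := by ring))

theorem inner_slice (T : HTensor H₁ K₁ →L[ℂ] HTensor H₂ K₂) (ω : NormalFunctional K₁ K₂)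
    (η : H₂) (ξ : H₁) : inner ℂ η (slice T ω ξ) = NormalFunctional.incl K₁ K₂ ω (matrixCoeff T η ξ) := by
  rw [slice, inner_ofConjForm]
  exact RCLike.conj_conj _

/-- The closed linear span `[(id ⊗ ω)(T) | ω ∈ B(K₁, K₂)_*]`. -/
def sliceSpan (T : HTensor H₁ K₁ →L[ℂ] HTensor H₂ K₂) : Submodule ℂ (H₁ →L[ℂ] H₂) :=
  (Submodule.span ℂ (Set.range (slice T))).topologicalClosure

end Normal

/-! ### `W*`-categories -/

/-- A `C*`-category. The adjoint `f*` is written `dagger f`. -/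
class CStarCategory (C : Type u) [Category.{v} C] where
  homNormedAddCommGroup (X Y : C) : NormedAddCommGroup (X ⟶ Y)
  homNormedSpace (X Y : C) : NormedSpace ℂ (X ⟶ Y)
  homCompleteSpace (X Y : C) : CompleteSpace (X ⟶ Y)
  add_comp {X Y Z : C} (f f' : X ⟶ Y) (g : Y ⟶ Z) : (f + f') ≫ g = f ≫ g + f' ≫ g
  comp_add {X Y Z : C} (f : X ⟶ Y) (g g' : Y ⟶ Z) : f ≫ (g + g') = f ≫ g + f ≫ g'
  smul_comp {X Y Z : C} (a : ℂ) (f : X ⟶ Y) (g : Y ⟶ Z) : (a • f) ≫ g = a • f ≫ g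
  comp_smul {X Y Z : C} (a : ℂ) (f : X ⟶ Y) (g : Y ⟶ Z) : f ≫ (a • g) = a • f ≫ g
  norm_comp_le {X Y Z : C} (f : X ⟶ Y) (g : Y ⟶ Z) : ‖f ≫ g‖ ≤ ‖f‖ * ‖g‖
  dagger {X Y : C} (f : X ⟶ Y) : Y ⟶ X
  dagger_add {X Y : C} (f g : X ⟶ Y) : dagger (f + g) = dagger f + dagger g
  dagger_smul {X Y : C} (a : ℂ) (f : X ⟶ Y) : dagger (a • f) = starRingEnd ℂ a • dagger f
  dagger_dagger {X Y : C} (f : X ⟶ Y) : dagger (dagger f) = f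
  dagger_comp {X Y Z : C} (f : X ⟶ Y) (g : Y ⟶ Z) : dagger (f ≫ g) = dagger g ≫ dagger f
  norm_dagger {X Y : C} (f : X ⟶ Y) : ‖dagger f‖ = ‖f‖
  norm_comp_dagger {X Y : C} (f : X ⟶ Y) : ‖f ≫ dagger f‖ = ‖f‖ ^ 2

attribute [reducible] CStarCategory.homNormedAddCommGroup CStarCategory.homNormedSpace

attribute [instance] CStarCategory.homNormedAddCommGroup CStarCategory.homNormedSpace
  CStarCategory.homCompleteSpace

open CStarCategory (dagger)

/-- A `W*`-category: every space of morphisms is the dual of a Banach space. -/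
class WStarCategory (C : Type u) [Category.{v} C] extends CStarCategory C where
  Predual (X Y : C) : Type v
  predualNormedAddCommGroup (X Y : C) : NormedAddCommGroup (Predual X Y)
  predualNormedSpace (X Y : C) : NormedSpace ℂ (Predual X Y)
  predualCompleteSpace (X Y : C) : CompleteSpace (Predual X Y)
  toDual (X Y : C) : (X ⟶ Y) ≃ₗᵢ[ℂ] StrongDual ℂ (Predual X Y)

attribute [reducible] WStarCategory.predualNormedAddCommGroup WStarCategory.predualNormedSpace

attribute [instance] WStarCategory.predualNormedAddCommGroup WStarCategory.predualNormedSpace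
  WStarCategory.predualCompleteSpace

section Categories

variable {C : Type u} [Category.{v} C]

/-- The ultraweak topology on a space of morphisms: the locally convex topology of pointwise
convergence on the predual. -/
abbrev ultraweakTopology [WStarCategory C] (X Y : C) : TopologicalSpace (X ⟶ Y) :=
  ⨅ ω : WStarCategory.Predual X Y,
    TopologicalSpace.induced (fun f => WStarCategory.toDual X Y f ω) inferInstance

/-- A map between spaces of morphisms is normal if it is ultraweakly continuous. -/
def IsNormalMap {D : Type*} [Category* D] [WStarCategory C] [WStarCategory D] {X Y : C} {X' Y' : D}
    (t : (X ⟶ Y) → (X' ⟶ Y')) : Prop :=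
  @Continuous _ _ (ultraweakTopology X Y) (ultraweakTopology X' Y') t

/-- Unitary morphisms. -/
def IsUnitary [CStarCategory C] {X Y : C} (f : X ⟶ Y) : Prop :=
  f ≫ dagger f = 𝟙 X ∧ dagger f ≫ f = 𝟙 Y

end Categories

/-- A monoidal `W*`-category: the tensor product is a normal bifunctor of `W*`-categories, i.e.
it is bilinear, compatible with adjoints and normal in each variable. -/
class MonoidalWStarCategory (C : Type u) [Category.{v} C] [MonoidalCategory C]
    extends WStarCategory C where
  add_tensor {X Y X' Y' : C} (f f' : X ⟶ Y) (g : X' ⟶ Y') :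
    (f + f') ⊗ₘ g = (f ⊗ₘ g) + (f' ⊗ₘ g)
  tensor_add {X Y X' Y' : C} (f : X ⟶ Y) (g g' : X' ⟶ Y') :
    f ⊗ₘ (g + g') = (f ⊗ₘ g) + (f ⊗ₘ g')
  smul_tensor {X Y X' Y' : C} (a : ℂ) (f : X ⟶ Y) (g : X' ⟶ Y') :
    (a • f) ⊗ₘ g = a • (f ⊗ₘ g)
  tensor_smul {X Y X' Y' : C} (a : ℂ) (f : X ⟶ Y) (g : X' ⟶ Y') :
    f ⊗ₘ (a • g) = a • (f ⊗ₘ g)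
  dagger_tensor {X Y X' Y' : C} (f : X ⟶ Y) (g : X' ⟶ Y') :
    dagger (f ⊗ₘ g) = dagger f ⊗ₘ dagger g
  normal_left {X Y X' Y' : C} (g : X' ⟶ Y') :
    IsNormalMap fun f : X ⟶ Y => f ⊗ₘ g
  normal_right {X Y X' Y' : C} (f : X ⟶ Y) :
    IsNormalMap fun g : X' ⟶ Y' => f ⊗ₘ g

instance : WStarCategory HilbCat.{w} where
  homNormedAddCommGroup H K := inferInstanceAs (NormedAddCommGroup (H →L[ℂ] K))
  homNormedSpace H K := inferInstanceAs (NormedSpace ℂ (H →L[ℂ] K))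
  homCompleteSpace H K := inferInstanceAs (CompleteSpace (H →L[ℂ] K))
  add_comp _ _ g := ContinuousLinearMap.comp_add (HilbCat.toCLM g) _ _
  comp_add _ g _ := ContinuousLinearMap.add_comp (HilbCat.toCLM g) _ _
  smul_comp a _ g := ContinuousLinearMap.comp_smul (HilbCat.toCLM g) a _
  comp_smul a _ g := ContinuousLinearMap.smul_comp a (HilbCat.toCLM g) _
  norm_comp_le f g :=
    (ContinuousLinearMap.opNorm_comp_le (HilbCat.toCLM g) (HilbCat.toCLM f)).trans
      (mul_comm _ _).le
  dagger f := ContinuousLinearMap.adjoint (HilbCat.toCLM f)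
  dagger_add f _ := map_add ContinuousLinearMap.adjoint (HilbCat.toCLM f) _
  dagger_smul a f :=
    LinearIsometryEquiv.map_smulₛₗ ContinuousLinearMap.adjoint a (HilbCat.toCLM f)
  dagger_dagger f := ContinuousLinearMap.adjoint_adjoint (HilbCat.toCLM f)
  dagger_comp f g :=
    ContinuousLinearMap.adjoint_comp (HilbCat.toCLM g) (HilbCat.toCLM f)
  norm_dagger {X Y} f := LinearIsometryEquiv.norm_map
    (ContinuousLinearMap.adjoint : (X →L[ℂ] Y) ≃ₗᵢ⋆[ℂ] (Y →L[ℂ] X)) (HilbCat.toCLM f)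
  norm_comp_dagger f :=
    (ContinuousLinearMap.norm_adjoint_comp_self (HilbCat.toCLM f)).trans (sq _).symm
  Predual H K := NormalFunctional H K
  predualNormedAddCommGroup _ _ := inferInstance
  predualNormedSpace _ _ := inferInstance
  predualCompleteSpace _ _ := inferInstance
  toDual H K := predualEquiv H K

/-! ### Concrete monoidal `W*`-categories and braided multiplicative unitaries -/

section Concrete

variable {C : Type u} [Category.{v} C] [MonoidalCategory C] [MonoidalWStarCategory C]

/-- The forgetful functor of a concrete monoidal `W*`-category: a normal `*`-functor to the
category of Hilbert spaces which is strong monoidal with unitary tensorators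
`For X ⊗ For Y → For (X ⊗ Y)`. -/
structure IsFibreFunctor (For : C ⥤ HilbCat.{w}) [For.Monoidal] : Prop where
  map_add {X Y : C} (f g : X ⟶ Y) : For.map (f + g) = For.map f + For.map g
  map_smul {X Y : C} (a : ℂ) (f : X ⟶ Y) : For.map (a • f) = a • For.map f
  map_dagger {X Y : C} (f : X ⟶ Y) : For.map (dagger f) = dagger (For.map f)
  normal (X Y : C) : IsNormalMap fun f : X ⟶ Y => For.map f
  unitary_tensorator (X Y : C) : IsUnitary (Functor.LaxMonoidal.μ For X Y)

variable (For : C ⥤ HilbCat.{w}) [For.Monoidal]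

/-- The operator `For X ⊗ For Y → For X' ⊗ For Y'` that underlies a morphism
`X ⊗ Y → X' ⊗ Y'`. -/
def legOp {X Y X' Y' : C} (f : X ⊗ Y ⟶ X' ⊗ Y') :
    HTensor (For.obj X) (For.obj Y) →L[ℂ] HTensor (For.obj X') (For.obj Y') :=
  HilbCat.toCLM (H := For.obj X ⊗ For.obj Y) (K := For.obj X' ⊗ For.obj Y')
    (Functor.LaxMonoidal.μ For X Y ≫ For.map f ≫ Functor.OplaxMonoidal.δ For X' Y')

/-- The closed linear span `[(id ⊗ ω)(f) | ω ∈ B(For Y, For Y')_*] ⊆ B(For X, For X')` of the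
right-leg slices of a morphism `f : X ⊗ Y → X' ⊗ Y'`. -/
def morphismSlices {X Y X' Y' : C} (f : X ⊗ Y ⟶ X' ⊗ Y') :
    Submodule ℂ (For.obj X →L[ℂ] For.obj X') :=
  sliceSpan (legOp For f)

/-- The braiding of `C` is semi-regular: it is unitary, and for all `X`, `Y` the compact operators
from `For X` to `For Y` are contained in `[(id ⊗ ω)(c_{X,Y}) | ω]`. -/
structure IsSemiRegularBraiding [BraidedCategory C] : Prop where
  unitary (X Y : C) : IsUnitary (β_ X Y).hom
  compact_mem (X Y : C) (T : For.obj X →L[ℂ] For.obj Y) (hT : IsCompactOperator T) :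
    T ∈ morphismSlices For (β_ X Y).hom

/-- `F` is a multiplicative unitary in `C`: it is unitary and, with `c = c_{L,L}`, satisfies
`F₂₃ F₁₂ = F₁₂ c₁₂⁻¹ F₂₃ c₁₂ F₂₃` on `(L ⊗ L) ⊗ L`. (Composition with `≫` is written in the
opposite order.) -/
structure IsMultiplicativeUnitary [BraidedCategory C] {L : C} (F : L ⊗ L ⟶ L ⊗ L) : Prop where
  unitary : IsUnitary F
  pentagon :
    let F₁₂ : (L ⊗ L) ⊗ L ⟶ (L ⊗ L) ⊗ L := F ▷ L
    let F₂₃ : (L ⊗ L) ⊗ L ⟶ (L ⊗ L) ⊗ L := (α_ L L L).hom ≫ L ◁ F ≫ (α_ L L L).inv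
    F₁₂ ≫ F₂₃ = F₂₃ ≫ (β_ L L).hom ▷ L ≫ F₂₃ ≫ (β_ L L).inv ▷ L ≫ F₁₂

/-- `Â(F) = [(id ⊗ ω)(F) | ω ∈ B(For L)_*]`. -/
def hatA {L : C} (F : L ⊗ L ⟶ L ⊗ L) : Submodule ℂ (For.obj L →L[ℂ] For.obj L) :=
  morphismSlices For F

/-- `C(F) = [(id ⊗ ω)(c_{L,L}⁻¹ F) | ω ∈ B(For L)_*]`. -/
def braidedC [BraidedCategory C] {L : C} (F : L ⊗ L ⟶ L ⊗ L) :
    Submodule ℂ (For.obj L →L[ℂ] For.obj L) :=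
  morphismSlices For (F ≫ (β_ L L).inv)

/-- `F` is semi-regular: `C(F)` contains the compact operators on `For L`. -/
def IsSemiRegular [BraidedCategory C] {L : C} (F : L ⊗ L ⟶ L ⊗ L) : Prop :=
  ∀ T : For.obj L →L[ℂ] For.obj L, IsCompactOperator T → T ∈ braidedC For F

end Concrete

/-- A subspace of `B(H)` is a (concrete) `C*`-algebra: it is norm closed and closed under
multiplication and adjoints. -/
def IsCStarSubalgebra {H : Type*} [NormedAddCommGroup H] [InnerProductSpace ℂ H]
    [CompleteSpace H] (S : Submodule ℂ (H →L[ℂ] H)) : Prop :=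
  ∃ A : NonUnitalStarSubalgebra ℂ (H →L[ℂ] H), IsClosed (A : Set (H →L[ℂ] H)) ∧
    (A : Set (H →L[ℂ] H)) = S

end BraidedMU

end

open BraidedMU

/-!
All slices are taken in the right leg, and `X₁₂`, `Y₂₃` act on `H ⊗ (H ⊗ H)` for `H = For L`. Four
facts about slices are used. Operators in the legs that are sliced are absorbed by the functionals
(`sliceSpan_legR_mul_legR_le`). The slices of `X₁₂` over the second and third leg are the slices of
`X` (`sliceSpan_leg12_le`, `sliceSpan_le_leg12`). The slices of `X₁₂ Y₂₃ Z₁₂` are spanned by the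
slices of `X (1 ⊗ y) Z`, where `y` runs through the slices of `Y` (`vecSlice_sandwich`). If `y =
|ξ⟩⟨η|` has rank one, a slice of `X (1 ⊗ y) Z` by vectors is a product of a slice of `X` and one of
`Z` (`vecSlice_mul_vecSlice`).

Naturality of the braiding rewrites the pentagon equation as `F₁₂ c₂₃ F₁₂ = F₂₃ F₁₂ F₂₃⁻¹ c₂₃`. The
slices of the right side lie in `Â(F)`. As the slices of `c` contain the rank one operators, the
slices of the left side contain `Â(F) Â(F)`; so `Â(F)` is an algebra.

With `w = c⁻¹ F`, the rewritten equation reads `F₁₂ w₂₃ F₁₂⁻¹ = c₂₃⁻¹ F₁₂⁻¹ F₂₃`. Thus `Â(F)*` is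
spanned by the slices of `F (1 ⊗ x) F*` with `x ∈ C(F)`, and it is self-adjoint if `C(F)` is.

With the braid equation one gets `w₂₃ w₁₂ w₂₃ = w₁₂ c₂₃⁻¹ w₁₂`, so that both `w₁₂ w₂₃ w₁₂⁻¹` and
`w₁₂⁻¹ w₂₃ w₁₂` have the form `u₂₃ w₁₂ v₂₃`, with slices in `C = C(F)`. If `C` contains the rank
one operators, this gives `C C* ⊆ C` and `C* C ⊆ C`. A closed subspace of a `C*`-algebra with these
properties is self-adjoint (`star_mem_of_mul_star_mem`): for `x ∈ C` the element `x* x` lies in `C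
∩ C*`, and `x` is a limit of elements `x p(x* x)` with `p(0) = 0`, which lie in `C ∩ C*`.
-/

noncomputable section

set_option linter.unusedSectionVars false

namespace BraidedMU

/-! ### Operators on Hilbert space tensor products -/

section Tensor

variable {H K L M N P : Type*}
  [NormedAddCommGroup H] [InnerProductSpace ℂ H]
  [NormedAddCommGroup K] [InnerProductSpace ℂ K]
  [NormedAddCommGroup L] [InnerProductSpace ℂ L]
  [NormedAddCommGroup M] [InnerProductSpace ℂ M]
  [NormedAddCommGroup N] [InnerProductSpace ℂ N]
  [NormedAddCommGroup P] [InnerProductSpace ℂ P]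

theorem hMap_comp (f' : K →L[ℂ] N) (g' : M →L[ℂ] P) (f : H →L[ℂ] K) (g : L →L[ℂ] M) :
    (hMap f' g').comp (hMap f g) = hMap (f'.comp f) (g'.comp g) :=
  hTensor_ext fun ξ η => by simp

theorem hMap_id_id : hMap (.id ℂ H) (.id ℂ K) = .id ℂ (HTensor H K) :=
  hTensor_ext fun ξ η => by simp

/-- Vectors of `H ⊗ K` are determined by inner products with elementary tensors. -/
theorem hTensor_ext_inner {x y : HTensor H K}
    (h : ∀ ξ η, inner ℂ (tmulL H K ξ η) x = inner ℂ (tmulL H K ξ η) y) : x = y := by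
  refine ext_inner_left ℂ fun v => ?_
  exact mem_of_tmulL_mem
    (LinearMap.eqLocus (innerSLFlip ℂ x).toLinearMap (innerSLFlip ℂ y).toLinearMap)
    (isClosed_eq (innerSLFlip ℂ x).continuous (innerSLFlip ℂ y).continuous) h v

/-- The operator `ξ ↦ ξ ⊗ η`. -/
def tmulR (H : Type*) {K : Type*} [NormedAddCommGroup H] [InnerProductSpace ℂ H]
    [NormedAddCommGroup K] [InnerProductSpace ℂ K] (η : K) : H →L[ℂ] HTensor H K :=
  (tmulL H K).flip η

@[simp] theorem tmulR_apply (η : K) (ξ : H) : tmulR H η ξ = tmulL H K ξ η := rfl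

variable [CompleteSpace H] [CompleteSpace K] [CompleteSpace L] [CompleteSpace M]

theorem adjoint_hMap (f : H →L[ℂ] K) (g : L →L[ℂ] M) :
    (hMap f g).adjoint = hMap f.adjoint g.adjoint :=
  hTensor_ext fun ξ η => hTensor_ext_inner fun ξ' η' => by
    simp [ContinuousLinearMap.adjoint_inner_right, inner_tmulL]

@[simp] theorem adjoint_tmulR_tmulL (η η' : K) (ξ : H) :
    (tmulR H η).adjoint (tmulL H K ξ η') = (inner ℂ η η' : ℂ) • ξ :=
  ext_inner_left ℂ fun ζ => by
    simp [ContinuousLinearMap.adjoint_inner_right, inner_tmulL, inner_smul_right, mul_comm]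

theorem hMap_rankOne (η η' : K) :
    hMap (.id ℂ H) (InnerProductSpace.rankOne ℂ η η') = (tmulR H η).comp (tmulR H η').adjoint :=
  hTensor_ext fun ξ ζ => by simp

theorem adjoint_tmulR_comp_tmulR (η η' : K) :
    (tmulR H η).adjoint.comp (tmulR H η') = (inner ℂ η η' : ℂ) • .id ℂ H := by
  ext; simp

end Tensor

theorem isCompactOperator_rankOne {H K : Type*}
    [NormedAddCommGroup H] [InnerProductSpace ℂ H] [NormedAddCommGroup K] [InnerProductSpace ℂ K]
    (ξ : K) (η : H) : IsCompactOperator (InnerProductSpace.rankOne ℂ ξ η) := by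
  have h := (isCompactOperator_id (E := ℂ)).comp_clm (innerSL ℂ η)
  exact h.clm_comp (ContinuousLinearMap.toSpanSingleton ℂ ξ)

/-! ### Leg numbering -/

section Legs

variable {H K M : Type*}
  [NormedAddCommGroup H] [InnerProductSpace ℂ H] [CompleteSpace H]
  [NormedAddCommGroup K] [InnerProductSpace ℂ K] [CompleteSpace K]
  [NormedAddCommGroup M] [InnerProductSpace ℂ M] [CompleteSpace M]

/-- The operator `X₁₂` on `H ⊗ (K ⊗ M)`, for `X` on `H ⊗ K`. -/
def leg12 (M : Type*) [NormedAddCommGroup M] [InnerProductSpace ℂ M] [CompleteSpace M] :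
    (HTensor H K →L[ℂ] HTensor H K) →⋆*
      (HTensor H (HTensor K M) →L[ℂ] HTensor H (HTensor K M)) where
  toFun X := (hAssoc H K M).toContinuousLinearEquiv.toContinuousLinearMap.comp
    ((hMap X (.id ℂ M)).comp (hAssoc H K M).symm.toContinuousLinearEquiv.toContinuousLinearMap)
  map_one' := by
    ext x
    change hAssoc H K M (hMap (.id ℂ _) (.id ℂ _) ((hAssoc H K M).symm x)) = x
    simp [hMap_id_id]
  map_mul' X Y := by
    ext x
    change hAssoc H K M (hMap (X.comp Y) (.id ℂ _) ((hAssoc H K M).symm x)) =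
      hAssoc H K M (hMap X (.id ℂ _) ((hAssoc H K M).symm (hAssoc H K M
        (hMap Y (.id ℂ _) ((hAssoc H K M).symm x)))))
    rw [LinearIsometryEquiv.symm_apply_apply, ← ContinuousLinearMap.comp_apply (hMap X _),
      hMap_comp]
    rfl
  map_star' X := by
    rw [ContinuousLinearMap.star_eq_adjoint, ContinuousLinearMap.star_eq_adjoint]
    refine (ContinuousLinearMap.eq_adjoint_iff _ _).2 fun x y => ?_
    change inner ℂ (hAssoc H K M (hMap X.adjoint (.id ℂ _) ((hAssoc H K M).symm x))) y =
      inner ℂ x (hAssoc H K M (hMap X (.id ℂ _) ((hAssoc H K M).symm y)))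
    rw [← LinearIsometryEquiv.inner_map_map (hAssoc H K M).symm,
      ← LinearIsometryEquiv.inner_map_map (hAssoc H K M).symm x,
      LinearIsometryEquiv.symm_apply_apply, LinearIsometryEquiv.symm_apply_apply,
      ← ContinuousLinearMap.adjoint_inner_left, adjoint_hMap, ContinuousLinearMap.adjoint_id]

theorem leg12_apply (X : HTensor H K →L[ℂ] HTensor H K) (x : HTensor H (HTensor K M)) :
    leg12 M X x = hAssoc H K M (hMap X (.id ℂ M) ((hAssoc H K M).symm x)) := rfl

/-- The operator `id ⊗ Y` on `H ⊗ K`, for `Y` on `K`. For a tensor product `K` this is `Y₂₃`. -/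
def legR (H : Type*) [NormedAddCommGroup H] [InnerProductSpace ℂ H] [CompleteSpace H] :
    (K →L[ℂ] K) →⋆ₐ[ℂ] (HTensor H K →L[ℂ] HTensor H K) where
  toFun Y := hMap (.id ℂ H) Y
  map_one' := hMap_id_id
  map_mul' X Y := by
    rw [ContinuousLinearMap.mul_def, ContinuousLinearMap.mul_def, hMap_comp,
      ContinuousLinearMap.id_comp]
  map_zero' := hTensor_ext fun ξ η => by simp
  map_add' X Y := hTensor_ext fun ξ η => by simp
  commutes' a := hTensor_ext fun ξ η => by simp [Algebra.algebraMap_eq_smul_one]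
  map_star' X := by
    rw [ContinuousLinearMap.star_eq_adjoint, ContinuousLinearMap.star_eq_adjoint, adjoint_hMap,
      ContinuousLinearMap.adjoint_id]

theorem legR_apply (Y : K →L[ℂ] K) : legR H Y = hMap (.id ℂ H) Y := rfl

theorem legR_comp_tmulR (Y : K →L[ℂ] K) (η : K) :
    (legR H Y).comp (tmulR H η) = tmulR H (Y η) := by
  ext ξ; simp [legR_apply]

/-- Creating `ξ ⊗ ξ'` and applying `X₁₂` amounts to creating `ξ`, applying `X`, creating `ξ'`. -/
theorem leg12_comp_tmulR (X : HTensor H K →L[ℂ] HTensor H K) (ξ : K) (ξ' : M) :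
    (leg12 M X).comp (tmulR H (tmulL K M ξ ξ')) =
      (hMap (.id ℂ H) (tmulR K ξ')).comp (X.comp (tmulR H ξ)) := by
  -- `|ξ'⟩` in the last leg is the same operator for both bracketings of the triple tensor product.
  have key : (hMap (.id ℂ H) (tmulR K ξ') : HTensor H K →L[ℂ] _) =
      (hAssoc H K M).toContinuousLinearEquiv.toContinuousLinearMap.comp (tmulR _ ξ') :=
    hTensor_ext fun ξ η => by simp
  ext θ
  rw [key]
  change leg12 M X (tmulL _ _ θ (tmulL K M ξ ξ')) =
    hAssoc H K M (tmulL _ _ (X (tmulL _ _ θ ξ)) ξ')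
  rw [leg12_apply, ← hAssoc_tmulL, LinearIsometryEquiv.symm_apply_apply, hMap_tmulL]
  rfl

end Legs

/-! ### Spaces of slices -/

theorem isClosed_comap_mulLeft {A : Type*} [NormedRing A] [NormedAlgebra ℂ A] {S : Submodule ℂ A}
    (hS : IsClosed (S : Set A)) (a : A) :
    IsClosed (S.comap (LinearMap.mulLeft ℂ a) : Set A) :=
  hS.preimage (continuous_const_mul a)

theorem isClosed_comap_mulRight {A : Type*} [NormedRing A] [NormedAlgebra ℂ A]
    {S : Submodule ℂ A} (hS : IsClosed (S : Set A)) (a : A) :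
    IsClosed (S.comap (LinearMap.mulRight ℂ a) : Set A) :=
  hS.preimage (continuous_mul_const a)

section Slices

variable {H K M : Type*}
  [NormedAddCommGroup H] [InnerProductSpace ℂ H] [CompleteSpace H]
  [NormedAddCommGroup K] [InnerProductSpace ℂ K] [CompleteSpace K]
  [NormedAddCommGroup M] [InnerProductSpace ℂ M] [CompleteSpace M]

/-- The slice of `T` by the vector functional of `η` and `ξ`. -/
def vecSlice (T : HTensor H K →L[ℂ] HTensor H K) (η ξ : K) : H →L[ℂ] H :=
  (tmulR H η).adjoint.comp (T.comp (tmulR H ξ))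

theorem slice_vector (T : HTensor H K →L[ℂ] HTensor H K) (η ξ : K) :
    slice T (NormalFunctional.vector η ξ) = vecSlice T η ξ := by
  ext x
  refine ext_inner_left ℂ fun y => ?_
  rw [inner_slice, NormalFunctional.incl_vector]
  simp [matrixCoeff, vecSlice, ContinuousLinearMap.adjoint_inner_right]

theorem norm_slice_le (T : HTensor H K →L[ℂ] HTensor H K) (ω : NormalFunctional K K) :
    ‖slice T ω‖ ≤ ‖T‖ * ‖ω‖ := by
  refine ContinuousLinearMap.opNorm_le_of_re_inner_le (by positivity) fun x y hx hy => ?_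
  rw [inner_re_symm, inner_slice]
  calc _ ≤ ‖NormalFunctional.incl K K ω (matrixCoeff T y x)‖ := RCLike.re_le_norm _
    _ ≤ ‖NormalFunctional.incl K K ω‖ * ‖matrixCoeff T y x‖ := ContinuousLinearMap.le_opNorm _ _
    _ ≤ ‖ω‖ * (‖T‖ * ‖x‖ * ‖y‖) := by
      rw [LinearIsometry.norm_map]; gcongr; exact norm_matrixCoeff_le T y x
    _ = _ := by rw [hx, hy]; ring

/-- Normal slices form a bounded linear map on the predual. -/
def sliceCLM (T : HTensor H K →L[ℂ] HTensor H K) : NormalFunctional K K →L[ℂ] H →L[ℂ] H :=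
  LinearMap.mkContinuous
    { toFun := slice T
      map_add' := fun ω ω' => by
        ext x; refine ext_inner_left ℂ fun y => ?_
        simp [inner_slice, inner_add_right]
      map_smul' := fun a ω => by
        ext x; refine ext_inner_left ℂ fun y => ?_
        simp [inner_slice, inner_smul_right] }
    ‖T‖ (norm_slice_le T)

/-- A closed subspace of the predual that contains the vector functionals is everything. -/
theorem NormalFunctional.induction_vector {S : Submodule ℂ (NormalFunctional K K)}
    (hS : IsClosed (S : Set (NormalFunctional K K)))
    (h : ∀ η ξ, NormalFunctional.vector η ξ ∈ S) (ω : NormalFunctional K K) : ω ∈ S := by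
  have hcl : IsClosed ((S.map (vectorSpan K K).topologicalClosure.subtype :
      Submodule ℂ (OpDual K K)) : Set (OpDual K K)) :=
    (Submodule.isClosed_topologicalClosure (vectorSpan K K)).isClosedEmbedding_subtypeVal.isClosedMap
      _ hS
  obtain ⟨ω', h1, h2⟩ := Submodule.topologicalClosure_minimal _
    (Submodule.span_le.2 (by rintro _ ⟨p, rfl⟩; exact ⟨_, h p.1 p.2, rfl⟩)) hcl ω.2
  rwa [← Subtype.ext h2]

theorem isClosed_sliceSpan (T : HTensor H K →L[ℂ] HTensor H K) :
    IsClosed (sliceSpan T : Set (H →L[ℂ] H)) :=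
  Submodule.isClosed_topologicalClosure _

theorem vecSlice_mem_sliceSpan (T : HTensor H K →L[ℂ] HTensor H K) (η ξ : K) :
    vecSlice T η ξ ∈ sliceSpan T :=
  Submodule.le_topologicalClosure _ (Submodule.subset_span ⟨_, slice_vector T η ξ⟩)

/-- Vector functionals suffice to generate the slices of an operator. -/
theorem sliceSpan_le {T : HTensor H K →L[ℂ] HTensor H K} {S : Submodule ℂ (H →L[ℂ] H)}
    (hS : IsClosed (S : Set (H →L[ℂ] H))) (h : ∀ η ξ, vecSlice T η ξ ∈ S) : sliceSpan T ≤ S := by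
  refine Submodule.topologicalClosure_minimal _ (Submodule.span_le.2 ?_) hS
  rintro _ ⟨ω, rfl⟩
  exact NormalFunctional.induction_vector (S := S.comap (sliceCLM T).toLinearMap)
    (hS.preimage (sliceCLM T).continuous) (fun η ξ => by
      change slice T _ ∈ S
      rw [slice_vector]; exact h η ξ) ω

theorem star_vecSlice (T : HTensor H K →L[ℂ] HTensor H K) (η ξ : K) :
    star (vecSlice T η ξ) = vecSlice (star T) ξ η := by
  simp only [vecSlice, ContinuousLinearMap.star_eq_adjoint, ContinuousLinearMap.adjoint_comp,
    ContinuousLinearMap.adjoint_adjoint, ContinuousLinearMap.comp_assoc]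

/-- The subspace `S*` of adjoints of elements of `S`. -/
def adjSpace (S : Submodule ℂ (H →L[ℂ] H)) : Submodule ℂ (H →L[ℂ] H) where
  carrier := {x | star x ∈ S}
  add_mem' hx hy := by
    rw [Set.mem_ofPred_eq, star_add]; exact S.add_mem hx hy
  zero_mem' := by
    rw [Set.mem_ofPred_eq, star_zero]; exact S.zero_mem
  smul_mem' a x hx := by
    rw [Set.mem_ofPred_eq, star_smul]; exact S.smul_mem _ hx

theorem mem_adjSpace {S : Submodule ℂ (H →L[ℂ] H)} {x : H →L[ℂ] H} :
    x ∈ adjSpace S ↔ star x ∈ S := Iff.rfl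

theorem isClosed_adjSpace {S : Submodule ℂ (H →L[ℂ] H)} (hS : IsClosed (S : Set (H →L[ℂ] H))) :
    IsClosed (adjSpace S : Set (H →L[ℂ] H)) :=
  hS.preimage continuous_star

theorem star_mem_sliceSpan_star {T : HTensor H K →L[ℂ] HTensor H K} {x : H →L[ℂ] H}
    (hx : x ∈ sliceSpan T) : star x ∈ sliceSpan (star T) :=
  sliceSpan_le (isClosed_adjSpace (isClosed_sliceSpan (star T))) (fun η ξ => by
    rw [mem_adjSpace, star_vecSlice]; exact vecSlice_mem_sliceSpan _ _ _) hx

theorem vecSlice_legR_mul_legR (T : HTensor H K →L[ℂ] HTensor H K) (U V : K →L[ℂ] K) (η ξ : K) :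
    vecSlice (legR H U * T * legR H V) η ξ = vecSlice T (star U η) (V ξ) := by
  have h : (tmulR H η).adjoint.comp (legR H U) = (tmulR H (star U η)).adjoint := by
    rw [← legR_comp_tmulR, map_star, ContinuousLinearMap.star_eq_adjoint,
      ContinuousLinearMap.adjoint_comp, ContinuousLinearMap.adjoint_adjoint]
  rw [vecSlice, vecSlice, ← h, ← legR_comp_tmulR]
  rfl

/-- Operators on the sliced leg are absorbed into the functionals. -/
theorem sliceSpan_legR_mul_legR_le (T : HTensor H K →L[ℂ] HTensor H K) (U V : K →L[ℂ] K) :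
    sliceSpan (legR H U * T * legR H V) ≤ sliceSpan T :=
  sliceSpan_le (isClosed_sliceSpan _) fun η ξ => by
    rw [vecSlice_legR_mul_legR]; exact vecSlice_mem_sliceSpan _ _ _

/-- The slices by elementary tensors of an operator with an operator in the second and third
leg sandwiched between two operators in the first and second leg. -/
theorem vecSlice_sandwich (X Z : HTensor H K →L[ℂ] HTensor H K)
    (Y : HTensor K M →L[ℂ] HTensor K M) (η ξ : K) (η' ξ' : M) :
    vecSlice (leg12 M X * legR H Y * leg12 M Z) (tmulL K M η η') (tmulL K M ξ ξ') =
      vecSlice (X * legR H (vecSlice Y η' ξ') * Z) η ξ := by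
  have h : (tmulR H (tmulL K M η η')).adjoint.comp (leg12 M X) =
      ((tmulR H η).adjoint.comp X).comp (hMap (.id ℂ H) (tmulR K η').adjoint) := by
    have := congrArg ContinuousLinearMap.adjoint (leg12_comp_tmulR (M := M) (star X) η η')
    rwa [ContinuousLinearMap.adjoint_comp, ContinuousLinearMap.adjoint_comp,
      ContinuousLinearMap.adjoint_comp, adjoint_hMap, ContinuousLinearMap.adjoint_id, map_star,
      ContinuousLinearMap.star_eq_adjoint, ContinuousLinearMap.star_eq_adjoint,
      ContinuousLinearMap.adjoint_adjoint, ContinuousLinearMap.adjoint_adjoint] at this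
  have hY : (hMap (.id ℂ H) (tmulR K η').adjoint).comp ((legR H Y).comp
      (hMap (.id ℂ H) (tmulR K ξ'))) = legR H (vecSlice Y η' ξ') := by
    rw [legR_apply, legR_apply, hMap_comp, hMap_comp]
    rfl
  change ((tmulR H (tmulL K M η η')).adjoint.comp (leg12 M X)).comp ((legR H Y).comp
    ((leg12 M Z).comp (tmulR H (tmulL K M ξ ξ')))) = _
  rw [h, leg12_comp_tmulR]
  change ((tmulR H η).adjoint.comp X).comp (((hMap (.id ℂ H) (tmulR K η').adjoint).comp
    ((legR H Y).comp (hMap (.id ℂ H) (tmulR K ξ')))).comp (Z.comp (tmulR H ξ))) = _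
  rw [hY]
  rfl

theorem vecSlice_mem_of_tmulL {T : HTensor H (HTensor K M) →L[ℂ] HTensor H (HTensor K M)}
    {S : Submodule ℂ (H →L[ℂ] H)} (hS : IsClosed (S : Set (H →L[ℂ] H))) {z : HTensor K M}
    (h : ∀ ξ ξ', vecSlice T z (tmulL K M ξ ξ') ∈ S) (w : HTensor K M) : vecSlice T z w ∈ S := by
  let f : HTensor K M →L[ℂ] H →L[ℂ] H :=
    (ContinuousLinearMap.compL ℂ H (HTensor H (HTensor K M)) H ((tmulR H z).adjoint.comp T)).comp
      (tmulL H (HTensor K M)).flip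
  exact mem_of_tmulL_mem (S.comap f.toLinearMap) (hS.preimage f.continuous) h w

/-- On a tensor product, slices by elementary tensors generate all slices. -/
theorem sliceSpan_le_of_tmulL {T : HTensor H (HTensor K M) →L[ℂ] HTensor H (HTensor K M)}
    {S : Submodule ℂ (H →L[ℂ] H)} (hS : IsClosed (S : Set (H →L[ℂ] H)))
    (h : ∀ η η' ξ ξ', vecSlice T (tmulL K M η η') (tmulL K M ξ ξ') ∈ S) : sliceSpan T ≤ S := by
  refine sliceSpan_le hS fun z w => ?_
  refine vecSlice_mem_of_tmulL hS (fun ξ ξ' => ?_) w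
  rw [← star_star (vecSlice _ _ _), ← mem_adjSpace, star_vecSlice]
  refine vecSlice_mem_of_tmulL (isClosed_adjSpace hS) (fun η η' => ?_) z
  rw [mem_adjSpace, star_vecSlice, star_star]
  exact h η η' ξ ξ'

/-- The slices of `X₁₂` are slices of `X`. -/
theorem sliceSpan_leg12_le (X : HTensor H K →L[ℂ] HTensor H K) :
    sliceSpan (leg12 M X) ≤ sliceSpan X := by
  refine sliceSpan_le_of_tmulL (isClosed_sliceSpan _) fun η η' ξ ξ' => ?_
  have h := vecSlice_sandwich X 1 (1 : HTensor K M →L[ℂ] HTensor K M) η ξ η' ξ'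
  have h1 : vecSlice (1 : HTensor K M →L[ℂ] HTensor K M) η' ξ' = (inner ℂ η' ξ' : ℂ) • 1 := by
    rw [vecSlice, ContinuousLinearMap.one_def, ContinuousLinearMap.id_comp,
      adjoint_tmulR_comp_tmulR]
    rfl
  rw [map_one, map_one, mul_one, mul_one, h1, mul_one] at h
  rw [h]
  have h2 := vecSlice_legR_mul_legR X 1 ((inner ℂ η' ξ' : ℂ) • 1) η ξ
  rw [map_one, one_mul] at h2
  rw [h2]
  exact vecSlice_mem_sliceSpan _ _ _

/-- The slices of `X` are slices of `X₁₂`. -/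
theorem sliceSpan_le_leg12 [Nontrivial M] (X : HTensor H K →L[ℂ] HTensor H K) :
    sliceSpan X ≤ sliceSpan (leg12 M X) := by
  obtain ⟨ζ, hζ⟩ := exists_norm_eq M zero_le_one
  refine sliceSpan_le (isClosed_sliceSpan _) fun η ξ => ?_
  have h := vecSlice_sandwich X 1 (1 : HTensor K M →L[ℂ] HTensor K M) η ξ ζ ζ
  have h1 : vecSlice (1 : HTensor K M →L[ℂ] HTensor K M) ζ ζ = 1 := by
    rw [vecSlice, ContinuousLinearMap.one_def, ContinuousLinearMap.id_comp,
      adjoint_tmulR_comp_tmulR, inner_self_eq_norm_sq_to_K, hζ]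
    simp [ContinuousLinearMap.one_def]
  rw [map_one, map_one, mul_one, mul_one, h1, map_one, mul_one, mul_one] at h
  rw [← h]
  exact vecSlice_mem_sliceSpan _ _ _

theorem continuous_vecSlice (η ξ : K) :
    Continuous fun T : HTensor H K →L[ℂ] HTensor H K => vecSlice T η ξ :=
  continuous_const.clm_comp (continuous_id.clm_comp continuous_const)

/-- By continuity `vecSlice_sandwich` extends from vector slices of `Y` to all of `sliceSpan Y`. -/
theorem vecSlice_sandwich_mem {X Z : HTensor H K →L[ℂ] HTensor H K}
    {Y : HTensor K M →L[ℂ] HTensor K M} {y : K →L[ℂ] K} (hy : y ∈ sliceSpan Y) (η ξ : K) :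
    vecSlice (X * legR H y * Z) η ξ ∈ sliceSpan (leg12 M X * legR H Y * leg12 M Z) := by
  let f : (K →L[ℂ] K) →ₗ[ℂ] H →L[ℂ] H :=
    { toFun := fun y => vecSlice (X * legR H y * Z) η ξ
      map_add' := fun y y' => by
        simp [vecSlice, mul_add, add_mul]
      map_smul' := fun a y => by
        simp [vecSlice] }
  have hf : Continuous f := (continuous_vecSlice η ξ).comp
    ((continuous_const.mul (map_continuous (legR H))).mul continuous_const)
  exact sliceSpan_le (S := (sliceSpan _).comap f) ((isClosed_sliceSpan _).preimage hf)
    (fun η' ξ' => by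
      change vecSlice (X * legR H (vecSlice Y η' ξ') * Z) η ξ ∈
        sliceSpan (leg12 M X * legR H Y * leg12 M Z)
      rw [← vecSlice_sandwich]
      exact vecSlice_mem_sliceSpan _ _ _) hy

theorem sliceSpan_sandwich_le {X Z : HTensor H K →L[ℂ] HTensor H K}
    {Y : HTensor K M →L[ℂ] HTensor K M} {S : Submodule ℂ (H →L[ℂ] H)}
    (hS : IsClosed (S : Set (H →L[ℂ] H)))
    (h : ∀ y ∈ sliceSpan Y, ∀ η ξ, vecSlice (X * legR H y * Z) η ξ ∈ S) :
    sliceSpan (leg12 M X * legR H Y * leg12 M Z) ≤ S :=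
  sliceSpan_le_of_tmulL hS fun η η' ξ ξ' => by
    rw [vecSlice_sandwich]
    exact h _ (vecSlice_mem_sliceSpan _ _ _) _ _

theorem vecSlice_mul_vecSlice (X Z : HTensor H K →L[ℂ] HTensor H K) (η ξ η' ξ' : K) :
    vecSlice X η ξ * vecSlice Z η' ξ' =
      vecSlice (X * legR H (InnerProductSpace.rankOne ℂ ξ η') * Z) η ξ' := by
  rw [legR_apply, hMap_rankOne]
  simp only [vecSlice, ContinuousLinearMap.mul_def, ContinuousLinearMap.comp_assoc]

theorem mul_mem_of_vecSlice_mul_mem {X Z : HTensor H K →L[ℂ] HTensor H K}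
    {S : Submodule ℂ (H →L[ℂ] H)} (hS : IsClosed (S : Set (H →L[ℂ] H)))
    (h : ∀ η ξ η' ξ', vecSlice X η ξ * vecSlice Z η' ξ' ∈ S) {x z : H →L[ℂ] H}
    (hx : x ∈ sliceSpan X) (hz : z ∈ sliceSpan Z) : x * z ∈ S := by
  have key (η ξ : K) : sliceSpan Z ≤ S.comap (LinearMap.mulLeft ℂ (vecSlice X η ξ)) :=
    sliceSpan_le (isClosed_comap_mulLeft hS _) fun η' ξ' => by
      rw [Submodule.mem_comap, LinearMap.mulLeft_apply]; exact h η ξ η' ξ'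
  have key' : sliceSpan X ≤ S.comap (LinearMap.mulRight ℂ z) :=
    sliceSpan_le (isClosed_comap_mulRight hS _) fun η ξ => by
      have := key η ξ hz
      rw [Submodule.mem_comap, LinearMap.mulLeft_apply] at this
      rwa [Submodule.mem_comap, LinearMap.mulRight_apply]
  have := key' hx
  rwa [Submodule.mem_comap, LinearMap.mulRight_apply] at this

/-- If the slices of `Y` contain the operators of rank one, then products of slices of `X` and `Z`
are slices of `X₁₂ Y₂₃ Z₁₂`: a rank one operator in the middle splits a slice into a product. -/
theorem mul_mem_sliceSpan_sandwich {X Z : HTensor H K →L[ℂ] HTensor H K}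
    {Y : HTensor K M →L[ℂ] HTensor K M}
    (hY : ∀ T : K →L[ℂ] K, IsCompactOperator T → T ∈ sliceSpan Y) {x z : H →L[ℂ] H}
    (hx : x ∈ sliceSpan X) (hz : z ∈ sliceSpan Z) :
    x * z ∈ sliceSpan (leg12 M X * legR H Y * leg12 M Z) :=
  mul_mem_of_vecSlice_mul_mem (isClosed_sliceSpan _) (fun η ξ η' ξ' => by
    rw [vecSlice_mul_vecSlice]
    exact vecSlice_sandwich_mem (hY _ (isCompactOperator_rankOne ξ η')) η ξ') hx hz

end Slices

/-! ### Consequences of the braided pentagon equation -/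

section Group

variable {G : Type*} [Group G] {c₁₂ c₂₃ f₁₂ f₂₃ : G}

/-- Naturality of the braiding turns `c₁₂⁻¹ f₂₃ c₁₂` into `c₂₃ f₁₂ c₂₃⁻¹` in the pentagon equation. -/
theorem pentagon_sandwich_braiding (hp : f₂₃ * f₁₂ = f₁₂ * c₁₂⁻¹ * f₂₃ * c₁₂ * f₂₃)
    (h₁ : c₁₂ * c₂₃ * f₁₂ = f₂₃ * c₁₂ * c₂₃) :
    f₁₂ * c₂₃ * f₁₂ = f₂₃ * f₁₂ * (f₂₃⁻¹ * c₂₃) := by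
  rw [hp]
  have : f₂₃ = c₁₂ * c₂₃ * f₁₂ * c₂₃⁻¹ * c₁₂⁻¹ := by rw [h₁]; group
  rw [this]; group

theorem pentagon_sandwich (hp : f₂₃ * f₁₂ = f₁₂ * c₁₂⁻¹ * f₂₃ * c₁₂ * f₂₃)
    (h₁ : c₁₂ * c₂₃ * f₁₂ = f₂₃ * c₁₂ * c₂₃) :
    f₁₂ * (c₂₃⁻¹ * f₂₃) * f₁₂⁻¹ = c₂₃⁻¹ * f₁₂⁻¹ * f₂₃ := by
  have h := pentagon_sandwich_braiding hp h₁
  have : f₂₃ = f₁₂ * c₂₃ * f₁₂ * (c₂₃⁻¹ * f₂₃) * f₁₂⁻¹ := by rw [h]; group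
  calc _ = c₂₃⁻¹ * f₁₂⁻¹ * (f₁₂ * c₂₃ * f₁₂ * (c₂₃⁻¹ * f₂₃) * f₁₂⁻¹) := by group
    _ = _ := by rw [← this]

/-- The operator `w = c⁻¹ f` satisfies `w₂₃ w₁₂ w₂₃ = w₁₂ c₂₃⁻¹ w₁₂`. -/
theorem pentagon_inv_braiding_mul (hp : f₂₃ * f₁₂ = f₁₂ * c₁₂⁻¹ * f₂₃ * c₁₂ * f₂₃)
    (h₁ : c₁₂ * c₂₃ * f₁₂ = f₂₃ * c₁₂ * c₂₃) (h₂ : c₂₃ * c₁₂ * f₂₃ = f₁₂ * c₂₃ * c₁₂)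
    (hY : c₁₂ * c₂₃ * c₁₂ = c₂₃ * c₁₂ * c₂₃) :
    (c₂₃⁻¹ * f₂₃) * (c₁₂⁻¹ * f₁₂) * (c₂₃⁻¹ * f₂₃) =
      (c₁₂⁻¹ * f₁₂) * c₂₃⁻¹ * (c₁₂⁻¹ * f₁₂) := by
  have h := pentagon_sandwich hp h₁
  have e₁ : f₁₂ * (c₂₃⁻¹ * f₂₃) = c₂₃⁻¹ * f₁₂⁻¹ * f₂₃ * f₁₂ := by rw [← h]; group
  have e₂ : c₁₂⁻¹ * c₂₃⁻¹ * f₁₂⁻¹ = f₂₃⁻¹ * c₁₂⁻¹ * c₂₃⁻¹ := by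
    have := congrArg (·⁻¹) h₂
    simpa [mul_assoc] using this.symm
  have e₃ : f₂₃ = c₁₂ * c₂₃ * f₁₂ * c₂₃⁻¹ * c₁₂⁻¹ := by rw [h₁]; group
  have e₄ : c₁₂⁻¹ * c₂₃⁻¹ * c₁₂ = c₂₃ * c₁₂⁻¹ * c₂₃⁻¹ := by
    have : c₁₂ = c₂₃ * c₁₂ * c₂₃ * c₁₂⁻¹ * c₂₃⁻¹ := by rw [← hY]; group
    calc _ = c₁₂⁻¹ * c₂₃⁻¹ * (c₂₃ * c₁₂ * c₂₃ * c₁₂⁻¹ * c₂₃⁻¹) := by rw [← this]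
      _ = _ := by group
  calc _ = (c₂₃⁻¹ * f₂₃) * (c₁₂⁻¹ * (f₁₂ * (c₂₃⁻¹ * f₂₃))) := by group
    _ = (c₂₃⁻¹ * f₂₃) * ((c₁₂⁻¹ * c₂₃⁻¹ * f₁₂⁻¹) * (f₂₃ * f₁₂)) := by rw [e₁]; group
    _ = (c₂₃⁻¹ * f₂₃) * ((f₂₃⁻¹ * c₁₂⁻¹ * c₂₃⁻¹) *
        ((c₁₂ * c₂₃ * f₁₂ * c₂₃⁻¹ * c₁₂⁻¹) * f₁₂)) := by rw [e₂, ← e₃]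
    _ = c₂₃⁻¹ * (c₁₂⁻¹ * c₂₃⁻¹ * c₁₂) * c₂₃ * f₁₂ * c₂₃⁻¹ * (c₁₂⁻¹ * f₁₂) := by group
    _ = _ := by rw [e₄]; group

end Group

/-! ### Self-adjointness of a closed space of operators -/

section SelfAdjoint

/-- Functional calculus reduces this to `t (1 - t) ^ (2 n) ≤ 1 / (n + 1)` for `0 ≤ t ≤ 1`. -/
theorem norm_mul_one_sub_pow_sq_le {A : Type*} [CStarAlgebra A] {x : A} (hx : ‖x‖ ≤ 1) (n : ℕ) :
    ‖x * (1 - star x * x) ^ n‖ ^ 2 ≤ 1 / ((n : ℝ) + 1) := by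
  set h := star x * x with hh
  have hsa : IsSelfAdjoint h := IsSelfAdjoint.star_mul_self x
  have hnorm : ‖h‖ ≤ 1 := by
    rw [hh, CStarRing.norm_star_mul_self]; nlinarith [norm_nonneg x]
  have e : star (x * (1 - h) ^ n) * (x * (1 - h) ^ n) =
      cfc (fun t : ℝ => t * (1 - t) ^ (2 * n)) h := by
    rw [cfc_mul (fun t : ℝ => t) (fun t : ℝ => (1 - t) ^ (2 * n)) h,
      cfc_pow (fun t : ℝ => 1 - t) (2 * n) h, cfc_sub (fun _ : ℝ => (1 : ℝ)) (fun t => t) h,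
      cfc_id' ℝ h, cfc_const_one ℝ h, star_mul, star_pow, star_sub, star_one, hsa.star_eq]
    have hc : Commute h (1 - h) := (Commute.one_right h).sub_right (Commute.refl h)
    calc (1 - h) ^ n * star x * (x * (1 - h) ^ n) = (1 - h) ^ n * h * (1 - h) ^ n := by
          rw [hh]; simp only [mul_assoc]
      _ = h * (1 - h) ^ (2 * n) := by
          rw [← (hc.pow_right n).eq, mul_assoc, ← pow_add, two_mul]
  rw [sq, ← CStarRing.norm_star_mul_self, e]
  refine norm_cfc_le (by positivity) fun t ht => ?_
  have ht0 : 0 ≤ t := spectrum_star_mul_self_nonneg t ht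
  have ht1 : t ≤ 1 := by
    have := norm_apply_le_norm_cfc (fun t : ℝ => t) h ht
    rw [cfc_id' ℝ h, Real.norm_of_nonneg ht0] at this
    exact this.trans hnorm
  have h1 : 0 ≤ 1 - t := by linarith
  have h1' : 1 - t ≤ 1 := by linarith
  rw [Real.norm_of_nonneg (by positivity), le_div_iff₀ (by positivity)]
  -- Bernoulli's inequality bounds `(n + 1) t` by `(1 + t) ^ n`.
  have hb : (n + 1) * t ≤ (1 + t) ^ n := by
    have := one_add_mul_le_pow (show (-2 : ℝ) ≤ t by linarith) n
    nlinarith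
  calc t * (1 - t) ^ (2 * n) * (n + 1) = (1 - t) ^ (2 * n) * ((n + 1) * t) := by ring
    _ ≤ (1 - t) ^ n * (1 + t) ^ n := by
      gcongr ?_ * ?_
      exact pow_le_pow_of_le_one h1 h1' (by omega)
    _ = (1 - t ^ 2) ^ n := by rw [← mul_pow]; ring
    _ ≤ 1 := pow_le_one₀ (by nlinarith) (by nlinarith)

/-- If `C C* ⊆ C` and `C* C ⊆ C` then `C` is self-adjoint: for `x ∈ C` with `‖x‖ ≤ 1`
the elements `x (1 - (1 - x* x)ⁿ)` belong to `C ∩ C*` and converge to `x`. -/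
theorem star_mem_of_mul_star_mem {A : Type*} [CStarAlgebra A] {S : Submodule ℂ A}
    (hS : IsClosed (S : Set A)) (h₁ : ∀ x ∈ S, ∀ y ∈ S, x * star y ∈ S)
    (h₂ : ∀ x ∈ S, ∀ y ∈ S, star x * y ∈ S) {x : A} (hx : x ∈ S) : star x ∈ S := by
  wlog hn : ‖x‖ ≤ 1 generalizing x
  · have hpos : 0 < ‖x‖ := by linarith
    have h := this (x := ((‖x‖⁻¹ : ℝ) : ℂ) • x) (S.smul_mem _ hx) (by
      rw [norm_smul, Complex.norm_real, norm_inv, norm_norm, inv_mul_cancel₀ hpos.ne'])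
    rw [star_smul] at h
    have h' := S.smul_mem ((‖x‖ : ℝ) : ℂ) h
    rw [smul_smul] at h'
    have : ((‖x‖ : ℝ) : ℂ) * star ((‖x‖⁻¹ : ℝ) : ℂ) = 1 := by
      rw [Complex.star_def, Complex.conj_ofReal, ← Complex.ofReal_mul, mul_inv_cancel₀ hpos.ne',
        Complex.ofReal_one]
    rwa [this, one_smul] at h'
  set h := star x * x with hh
  have hsa : star h = h := by simp [hh]
  have hmem : h ∈ S := h₂ x hx x hx
  have hmul {y : A} (hy : y ∈ S) : y * h ∈ S ∧ star (y * h) ∈ S := by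
    refine ⟨by rw [← hsa]; exact h₁ y hy h hmem, ?_⟩
    rw [star_mul, hsa]; exact h₁ h hmem y hy
  have hpow (n : ℕ) : x - x * (1 - h) ^ n ∈ S ∧ star (x - x * (1 - h) ^ n) ∈ S := by
    induction n with
    | zero => simp
    | succ n ih =>
      have e : x - x * (1 - h) ^ (n + 1) =
          (x - x * (1 - h) ^ n) + x * h - (x - x * (1 - h) ^ n) * h := by
        rw [pow_succ]; noncomm_ring
      rw [e, star_sub, star_add]
      exact ⟨S.sub_mem (S.add_mem ih.1 (hmul hx).1) (hmul ih.1).1,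
        S.sub_mem (S.add_mem ih.2 (hmul hx).2) (hmul ih.1).2⟩
  have hlim : Filter.Tendsto (fun n : ℕ => star (x - x * (1 - h) ^ n)) Filter.atTop
      (nhds (star x)) := by
    refine (continuous_star.tendsto x).comp ?_
    have h0 : Filter.Tendsto (fun n : ℕ => x * (1 - h) ^ n) Filter.atTop (nhds 0) := by
      refine squeeze_zero_norm (a := fun n : ℕ => √(1 / ((n : ℝ) + 1))) (fun n => ?_) ?_
      · exact Real.le_sqrt_of_sq_le (norm_mul_one_sub_pow_sq_le hn n)
      · have := (Real.continuous_sqrt.tendsto 0).comp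
          (tendsto_one_div_add_atTop_nhds_zero_nat (𝕜 := ℝ))
        rwa [Real.sqrt_zero] at this
    simpa using tendsto_const_nhds.sub h0
  exact hS.mem_of_tendsto hlim (Filter.Eventually.of_forall fun n => (hpow n).2)

end SelfAdjoint

/-! ### Braided multiplicative unitaries on a Hilbert space -/

section Operators

variable {H : Type*} [NormedAddCommGroup H] [InnerProductSpace ℂ H] [CompleteSpace H]

/-- The map `u ↦ u₁₂` on unitaries. -/
def unitary12 : unitary (HTensor H H →L[ℂ] HTensor H H) →*
    unitary (HTensor H (HTensor H H) →L[ℂ] HTensor H (HTensor H H)) :=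
  (Unitary.map (leg12 H)).toMonoidHom

/-- The map `u ↦ u₂₃` on unitaries. -/
def unitary23 : unitary (HTensor H H →L[ℂ] HTensor H H) →*
    unitary (HTensor H (HTensor H H) →L[ℂ] HTensor H (HTensor H H)) where
  toFun u := ⟨legR H u, Unitary.map_mem (legR H) u.2⟩
  map_one' := Subtype.ext (map_one (legR H))
  map_mul' _ _ := Subtype.ext (map_mul (legR H) _ _)

/-- The space of slices of a unitary. -/
def unitarySlices {K : Type*} [NormedAddCommGroup K] [InnerProductSpace ℂ K] [CompleteSpace K]
    (u : unitary (HTensor H K →L[ℂ] HTensor H K)) : Submodule ℂ (H →L[ℂ] H) :=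
  sliceSpan (u : HTensor H K →L[ℂ] HTensor H K)

theorem isClosed_unitarySlices (u : unitary (HTensor H H →L[ℂ] HTensor H H)) :
    IsClosed (unitarySlices u : Set (H →L[ℂ] H)) :=
  isClosed_sliceSpan _

theorem star_mem_unitarySlices_inv {u : unitary (HTensor H H →L[ℂ] HTensor H H)} {x : H →L[ℂ] H}
    (hx : x ∈ unitarySlices u) : star x ∈ unitarySlices u⁻¹ :=
  star_mem_sliceSpan_star hx

/-- Unitaries in the legs that are sliced do not matter: the slices of `u₂₃ v₁₂ w₂₃` are those of
`v`. The reverse inclusion is `unitarySlices_le_legs`. -/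
theorem unitarySlices_legs_le (u v w : unitary (HTensor H H →L[ℂ] HTensor H H)) :
    unitarySlices (unitary23 u * unitary12 v * unitary23 w) ≤ unitarySlices v :=
  (sliceSpan_legR_mul_legR_le _ _ _).trans (sliceSpan_leg12_le _)

theorem unitarySlices_le_legs [Nontrivial H] (u v w : unitary (HTensor H H →L[ℂ] HTensor H H)) :
    unitarySlices v ≤ unitarySlices (unitary23 u * unitary12 v * unitary23 w) := by
  have h : unitary12 v = unitary23 u⁻¹ * (unitary23 u * unitary12 v * unitary23 w) *
      unitary23 w⁻¹ := by
    rw [map_inv, map_inv]; group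
  refine (sliceSpan_le_leg12 (M := H) _).trans ?_
  change unitarySlices (unitary12 v) ≤ _
  conv_lhs => rw [h]
  exact sliceSpan_legR_mul_legR_le _ _ _

theorem vecSlice_mem_unitarySlices {u v w : unitary (HTensor H H →L[ℂ] HTensor H H)}
    {y : H →L[ℂ] H} (hy : y ∈ unitarySlices v) (η ξ : H) :
    vecSlice ((u : HTensor H H →L[ℂ] HTensor H H) * legR H y *
      (w : HTensor H H →L[ℂ] HTensor H H)) η ξ ∈
        unitarySlices (unitary12 u * unitary23 v * unitary12 w) :=
  vecSlice_sandwich_mem hy η ξ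

theorem unitarySlices_sandwich_le {u v w : unitary (HTensor H H →L[ℂ] HTensor H H)}
    {S : Submodule ℂ (H →L[ℂ] H)} (hS : IsClosed (S : Set (H →L[ℂ] H)))
    (h : ∀ y ∈ unitarySlices v, ∀ η ξ, vecSlice ((u : HTensor H H →L[ℂ] HTensor H H) *
      legR H y * (w : HTensor H H →L[ℂ] HTensor H H)) η ξ ∈ S) :
    unitarySlices (unitary12 u * unitary23 v * unitary12 w) ≤ S :=
  sliceSpan_sandwich_le hS h

theorem star_vecSlice_sandwich (u : unitary (HTensor H H →L[ℂ] HTensor H H)) (y : H →L[ℂ] H)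
    (η ξ : H) :
    star (vecSlice ((u : HTensor H H →L[ℂ] HTensor H H) * legR H y *
      ((u⁻¹ : unitary (HTensor H H →L[ℂ] HTensor H H)) : HTensor H H →L[ℂ] HTensor H H)) η ξ) =
      vecSlice ((u : HTensor H H →L[ℂ] HTensor H H) * legR H (star y) *
        ((u⁻¹ : unitary (HTensor H H →L[ℂ] HTensor H H)) : HTensor H H →L[ℂ] HTensor H H)) ξ η := by
  rw [star_vecSlice, star_mul, star_mul, map_star, ← Unitary.star_eq_inv, Unitary.coe_star,
    star_star, mul_assoc]

theorem mul_mem_unitarySlices {u v w : unitary (HTensor H H →L[ℂ] HTensor H H)}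
    (hv : ∀ T : H →L[ℂ] H, IsCompactOperator T → T ∈ unitarySlices v) {x y : H →L[ℂ] H}
    (hx : x ∈ unitarySlices u) (hy : y ∈ unitarySlices w) :
    x * y ∈ unitarySlices (unitary12 u * unitary23 v * unitary12 w) :=
  mul_mem_sliceSpan_sandwich hv hx hy

/-- A braided pentagon equation on a Hilbert space: `c` satisfies the braid equation, `F` is
natural for it, and `F₂₃ F₁₂ = F₁₂ c₁₂⁻¹ F₂₃ c₁₂ F₂₃`. -/
structure BraidedPentagon (c F : unitary (HTensor H H →L[ℂ] HTensor H H)) : Prop where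
  pentagon : unitary23 F * unitary12 F =
    unitary12 F * (unitary12 c)⁻¹ * unitary23 F * unitary12 c * unitary23 F
  natural₁ : unitary12 c * unitary23 c * unitary12 F = unitary23 F * unitary12 c * unitary23 c
  natural₂ : unitary23 c * unitary12 c * unitary23 F = unitary12 F * unitary23 c * unitary12 c
  braid : unitary12 c * unitary23 c * unitary12 c = unitary23 c * unitary12 c * unitary23 c

variable {c F : unitary (HTensor H H →L[ℂ] HTensor H H)}

/-- `Â(F)` is closed under products, since the slices of `F₁₂ c₂₃ F₁₂ = F₂₃ F₁₂ F₂₃⁻¹ c₂₃` lie in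
`Â(F)` and contain the products of slices of `F`. -/
theorem BraidedPentagon.mul_mem (h : BraidedPentagon c F)
    (hc : ∀ T : H →L[ℂ] H, IsCompactOperator T → T ∈ unitarySlices c)
    {x y : H →L[ℂ] H} (hx : x ∈ unitarySlices F) (hy : y ∈ unitarySlices F) :
    x * y ∈ unitarySlices F := by
  have := mul_mem_unitarySlices hc hx hy
  rw [pentagon_sandwich_braiding h.pentagon h.natural₁, ← map_inv, ← map_mul] at this
  exact unitarySlices_legs_le _ _ _ this

/-- If `C(F)` is self-adjoint then so is `Â(F)`: the space `Â(F)*` is spanned by the slices of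
`F (1 ⊗ x) F*` for `x ∈ C(F)`. -/
theorem BraidedPentagon.star_mem (h : BraidedPentagon c F)
    (hC : ∀ x ∈ unitarySlices (c⁻¹ * F), star x ∈ unitarySlices (c⁻¹ * F))
    {x : H →L[ℂ] H} (hx : x ∈ unitarySlices F) : star x ∈ unitarySlices F := by
  -- Recovering all slices of `u` from those of `u₁₂` needs a unit vector in the last leg.
  rcases subsingleton_or_nontrivial H with hH | hH
  · rwa [Subsingleton.elim (star x) x]
  have e : unitary12 F * unitary23 (c⁻¹ * F) * unitary12 F⁻¹ =
      unitary23 c⁻¹ * unitary12 F⁻¹ * unitary23 F := by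
    have := pentagon_sandwich h.pentagon h.natural₁
    rwa [← map_inv, ← map_mul, ← map_inv] at this
  have hle : unitarySlices (unitary12 F * unitary23 (c⁻¹ * F) * unitary12 F⁻¹) ≤
      unitarySlices F⁻¹ := by
    rw [e]; exact unitarySlices_legs_le _ _ _
  have hsub : unitarySlices F⁻¹ ≤ adjSpace (unitarySlices F⁻¹) := by
    refine (unitarySlices_le_legs c⁻¹ F⁻¹ F).trans ?_
    rw [← e]
    refine unitarySlices_sandwich_le (isClosed_adjSpace (isClosed_unitarySlices _))
      fun y hy η ξ => ?_
    rw [mem_adjSpace, star_vecSlice_sandwich]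
    exact hle (vecSlice_mem_unitarySlices (hC y hy) ξ η)
  have := hsub (star_mem_unitarySlices_inv hx)
  rw [mem_adjSpace] at this
  simpa using star_mem_unitarySlices_inv this

/-- If `C(F)` contains the compact operators then it is self-adjoint. With `w = c⁻¹ F`, the
inclusions `C C* ⊆ C` and `C* C ⊆ C` come from `w₁₂ w₂₃ w₁₂⁻¹ = w₂₃⁻¹ w₁₂ c₂₃⁻¹` and
`w₁₂⁻¹ w₂₃ w₁₂ = c₂₃⁻¹ w₁₂ w₂₃⁻¹`. -/
theorem BraidedPentagon.star_mem_of_compact (h : BraidedPentagon c F)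
    (hK : ∀ T : H →L[ℂ] H, IsCompactOperator T → T ∈ unitarySlices (c⁻¹ * F))
    {x : H →L[ℂ] H} (hx : x ∈ unitarySlices (c⁻¹ * F)) : star x ∈ unitarySlices (c⁻¹ * F) := by
  have e := pentagon_inv_braiding_mul h.pentagon h.natural₁ h.natural₂ h.braid
  simp only [← map_inv, ← map_mul] at e
  have e₁ : unitary12 (c⁻¹ * F) * unitary23 (c⁻¹ * F) * unitary12 (c⁻¹ * F)⁻¹ =
      unitary23 (c⁻¹ * F)⁻¹ * unitary12 (c⁻¹ * F) * unitary23 c⁻¹ := by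
    rw [map_inv unitary12 (c⁻¹ * F), map_inv unitary23 (c⁻¹ * F), mul_inv_eq_iff_eq_mul,
      mul_assoc, mul_assoc, eq_inv_mul_iff_mul_eq, ← mul_assoc, ← mul_assoc, e]
  have e₂ : unitary12 (c⁻¹ * F)⁻¹ * unitary23 (c⁻¹ * F) * unitary12 (c⁻¹ * F) =
      unitary23 c⁻¹ * unitary12 (c⁻¹ * F) * unitary23 (c⁻¹ * F)⁻¹ := by
    rw [map_inv unitary12 (c⁻¹ * F), map_inv unitary23 (c⁻¹ * F), eq_mul_inv_iff_mul_eq,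
      mul_assoc, mul_assoc, inv_mul_eq_iff_eq_mul, ← mul_assoc, ← mul_assoc, e]
  refine star_mem_of_mul_star_mem (isClosed_unitarySlices _) (fun x hx y hy => ?_)
    (fun x hx y hy => ?_) hx
  · have := mul_mem_unitarySlices hK hx (star_mem_unitarySlices_inv hy)
    rw [e₁] at this
    exact unitarySlices_legs_le _ _ _ this
  · have := mul_mem_unitarySlices hK (star_mem_unitarySlices_inv hx) hy
    rw [e₂] at this
    exact unitarySlices_legs_le _ _ _ this

/-- If `C(F)` is self-adjoint then `Â(F)` is a `C*`-algebra. -/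
theorem BraidedPentagon.isCStarSubalgebra (h : BraidedPentagon c F)
    (hc : ∀ T : H →L[ℂ] H, IsCompactOperator T → T ∈ unitarySlices c)
    (hC : ∀ x ∈ unitarySlices (c⁻¹ * F), star x ∈ unitarySlices (c⁻¹ * F)) :
    IsCStarSubalgebra (unitarySlices F) :=
  ⟨{ unitarySlices F with
      mul_mem' := h.mul_mem hc
      star_mem' := h.star_mem hC }, isClosed_unitarySlices F, rfl⟩

end Operators

/-! ### Braid relations in a braided monoidal category -/

section Braided

variable {C : Type u} [Category.{v} C] [MonoidalCategory C] {L : C}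

/-- The endomorphism `f₂₃` of `(L ⊗ L) ⊗ L`. -/
def homLeg23 (f : L ⊗ L ⟶ L ⊗ L) : (L ⊗ L) ⊗ L ⟶ (L ⊗ L) ⊗ L :=
  (α_ L L L).hom ≫ L ◁ f ≫ (α_ L L L).inv

variable [BraidedCategory C]

theorem whiskerRight_braiding_natural (f : L ⊗ L ⟶ L ⊗ L) :
    f ▷ L ≫ homLeg23 (β_ L L).hom ≫ (β_ L L).hom ▷ L =
      homLeg23 (β_ L L).hom ≫ (β_ L L).hom ▷ L ≫ homLeg23 f := by
  have h : homLeg23 (β_ L L).hom ≫ (β_ L L).hom ▷ L =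
      (β_ (L ⊗ L) L).hom ≫ (α_ L L L).inv := by
    simp [homLeg23, BraidedCategory.braiding_tensor_left_hom]
  rw [← Category.assoc (homLeg23 _), h, homLeg23, Category.assoc, Iso.inv_hom_id_assoc,
    ← BraidedCategory.braiding_naturality_left_assoc]

theorem homLeg23_braiding_natural (f : L ⊗ L ⟶ L ⊗ L) :
    homLeg23 f ≫ (β_ L L).hom ▷ L ≫ homLeg23 (β_ L L).hom =
      (β_ L L).hom ▷ L ≫ homLeg23 (β_ L L).hom ≫ f ▷ L := by
  have h : (β_ L L).hom ▷ L ≫ homLeg23 (β_ L L).hom =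
      (α_ L L L).hom ≫ (β_ L (L ⊗ L)).hom := by
    simp [homLeg23, BraidedCategory.braiding_tensor_right_hom]
  rw [← Category.assoc ((β_ L L).hom ▷ L), h, homLeg23, Category.assoc, Category.assoc,
    Iso.inv_hom_id_assoc, BraidedCategory.braiding_naturality_right, Category.assoc]

theorem braiding_braid : (β_ L L).hom ▷ L ≫ homLeg23 (β_ L L).hom ≫ (β_ L L).hom ▷ L =
    homLeg23 (β_ L L).hom ≫ (β_ L L).hom ▷ L ≫ homLeg23 (β_ L L).hom :=
  whiskerRight_braiding_natural _

end Braided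

/-! ### Passing to operators -/

section Transfer

open Functor.LaxMonoidal Functor.OplaxMonoidal CStarCategory

variable {C : Type u} [Category.{v} C] [MonoidalCategory C]
variable (For : C ⥤ HilbCat.{w}) [For.Monoidal] {L : C}

theorem legOp_comp (f g : L ⊗ L ⟶ L ⊗ L) : legOp For (f ≫ g) = legOp For g * legOp For f := by
  change _ = HilbCat.toCLM ((μ For L L ≫ For.map f ≫ δ For L L) ≫
    (μ For L L ≫ For.map g ≫ δ For L L))
  rw [legOp]
  simp

theorem legOp_id : legOp For (𝟙 (L ⊗ L)) = 1 := by
  change _ = HilbCat.toCLM (𝟙 (For.obj L ⊗ For.obj L))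
  simp [legOp]

/-- The identification of `For L ⊗ (For L ⊗ For L)` with `For ((L ⊗ L) ⊗ L)`. -/
def tripleIso (L : C) : For.obj L ⊗ (For.obj L ⊗ For.obj L) ≅ For.obj ((L ⊗ L) ⊗ L) :=
  (α_ _ _ _).symm ≪≫ whiskerRightIso (Functor.Monoidal.μIso For L L) _ ≪≫
    Functor.Monoidal.μIso For (L ⊗ L) L

/-- The operator on `For L ⊗ (For L ⊗ For L)` that underlies an endomorphism of `(L ⊗ L) ⊗ L`. -/
def tripleOp (f : (L ⊗ L) ⊗ L ⟶ (L ⊗ L) ⊗ L) :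
    HTensor (For.obj L) (HTensor (For.obj L) (For.obj L)) →L[ℂ]
      HTensor (For.obj L) (HTensor (For.obj L) (For.obj L)) :=
  HilbCat.toCLM (H := For.obj L ⊗ (For.obj L ⊗ For.obj L))
    (K := For.obj L ⊗ (For.obj L ⊗ For.obj L))
    ((tripleIso For L).hom ≫ For.map f ≫ (tripleIso For L).inv)

theorem tripleOp_comp (f g : (L ⊗ L) ⊗ L ⟶ (L ⊗ L) ⊗ L) :
    tripleOp For (f ≫ g) = tripleOp For g * tripleOp For f := by
  change _ = HilbCat.toCLM (((tripleIso For L).hom ≫ For.map f ≫ (tripleIso For L).inv) ≫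
    ((tripleIso For L).hom ≫ For.map g ≫ (tripleIso For L).inv))
  rw [tripleOp]
  simp

theorem tripleOp_whiskerRight (f : L ⊗ L ⟶ L ⊗ L) :
    tripleOp For (f ▷ L) = leg12 (For.obj L) (legOp For f) := by
  change HilbCat.toCLM _ = HilbCat.toCLM ((α_ (For.obj L) (For.obj L) (For.obj L)).inv ≫
    (μ For L L ≫ For.map f ≫ δ For L L) ▷ For.obj L ≫ (α_ _ _ _).hom)
  congr 1
  rw [← cancel_mono (tripleIso For L).hom]
  simp [tripleIso]

theorem tripleOp_homLeg23 (f : L ⊗ L ⟶ L ⊗ L) :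
    tripleOp For (homLeg23 f) = legR (For.obj L) (legOp For f) := by
  change HilbCat.toCLM _ = HilbCat.toCLM (For.obj L ◁ (μ For L L ≫ For.map f ≫ δ For L L))
  congr 1
  have h : (tripleIso For L).hom ≫ For.map (α_ L L L).hom =
      For.obj L ◁ μ For L L ≫ μ For L (L ⊗ L) := by
    simp [tripleIso]
  rw [← cancel_mono ((tripleIso For L).hom ≫ For.map (α_ L L L).hom), homLeg23]
  simp only [Functor.map_comp, Category.assoc, Iso.inv_hom_id_assoc]
  rw [← Functor.map_comp, Iso.inv_hom_id, CategoryTheory.Functor.map_id, Category.comp_id,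
    reassoc_of% h, h]
  simp

end Transfer

section Unitary

open Functor.LaxMonoidal Functor.OplaxMonoidal CStarCategory

variable {C : Type u} [Category.{v} C] [MonoidalCategory C] [MonoidalWStarCategory C]
variable {For : C ⥤ HilbCat.{w}} [For.Monoidal] {L : C}

theorem legOp_dagger (hFor : IsFibreFunctor For) (f : L ⊗ L ⟶ L ⊗ L) :
    legOp For (dagger f) = star (legOp For f) := by
  have h : dagger (μ For L L) = δ For L L := by
    rw [← cancel_epi (μ For L L), (hFor.unitary_tensorator L L).1, Functor.Monoidal.μ_δ]
  have h' : dagger (δ For L L) = μ For L L := by rw [← h, dagger_dagger]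
  change _ = HilbCat.toCLM (dagger (μ For L L ≫ For.map f ≫ δ For L L))
  rw [dagger_comp, dagger_comp, h, h', ← hFor.map_dagger, Category.assoc]
  rfl

/-- The unitary operator that underlies a unitary endomorphism of `L ⊗ L`. -/
def unitaryOp (hFor : IsFibreFunctor For) (f : L ⊗ L ⟶ L ⊗ L) (hf : IsUnitary f) :
    unitary (HTensor (For.obj L) (For.obj L) →L[ℂ] HTensor (For.obj L) (For.obj L)) :=
  ⟨legOp For f, by
    rw [Unitary.mem_iff, ← legOp_dagger hFor, ← legOp_comp, ← legOp_comp, hf.1, hf.2, legOp_id]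
    exact ⟨rfl, rfl⟩⟩

variable [BraidedCategory C]

theorem legOp_braiding_inv (hFor : IsFibreFunctor For) (hc : IsUnitary (β_ L L).hom) :
    legOp For (β_ L L).inv = ((unitaryOp hFor _ hc)⁻¹ :
      unitary (HTensor (For.obj L) (For.obj L) →L[ℂ] _)) := by
  have : (β_ L L).inv = dagger (β_ L L).hom := by
    rw [← cancel_epi (β_ L L).hom, hc.1, Iso.hom_inv_id]
  rw [this, legOp_dagger hFor]
  rfl

theorem braidedPentagon_unitaryOp (hFor : IsFibreFunctor For) (hc : IsUnitary (β_ L L).hom)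
    {F : L ⊗ L ⟶ L ⊗ L} (hF : IsMultiplicativeUnitary F) :
    BraidedPentagon (unitaryOp hFor _ hc) (unitaryOp hFor F hF.unitary) := by
  have key {f g : (L ⊗ L) ⊗ L ⟶ (L ⊗ L) ⊗ L} (h : f = g) := congrArg (tripleOp For) h
  refine ⟨Subtype.ext ?_, Subtype.ext ?_, Subtype.ext ?_, Subtype.ext ?_⟩
  · have h := key (f := F ▷ L ≫ homLeg23 F) (g := homLeg23 F ≫ (β_ L L).hom ▷ L ≫
      homLeg23 F ≫ (β_ L L).inv ▷ L ≫ F ▷ L) hF.pentagon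
    simp only [tripleOp_comp, tripleOp_whiskerRight, tripleOp_homLeg23] at h
    rw [legOp_braiding_inv hFor hc] at h
    rw [← map_inv]
    exact h
  · have h := key (whiskerRight_braiding_natural F)
    simp only [tripleOp_comp, tripleOp_whiskerRight, tripleOp_homLeg23] at h
    exact h
  · have h := key (homLeg23_braiding_natural F)
    simp only [tripleOp_comp, tripleOp_whiskerRight, tripleOp_homLeg23] at h
    exact h
  · have h := key (braiding_braid (L := L))
    simp only [tripleOp_comp, tripleOp_whiskerRight, tripleOp_homLeg23] at h
    exact h

theorem braidedC_eq (hFor : IsFibreFunctor For) (hc : IsUnitary (β_ L L).hom)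
    {F : L ⊗ L ⟶ L ⊗ L} (hF : IsUnitary F) :
    braidedC For F = unitarySlices ((unitaryOp hFor _ hc)⁻¹ * unitaryOp hFor F hF) := by
  rw [braidedC, morphismSlices, legOp_comp, legOp_braiding_inv hFor hc]
  rfl

end Unitary

end BraidedMU

end

theorem mainTheorem4 {C : Type u} [Category.{v} C] [MonoidalCategory C] [BraidedCategory C]
    [MonoidalWStarCategory C] (For : C ⥤ HilbCat.{w}) [For.Monoidal] (hFor : IsFibreFunctor For)
    (hc : IsSemiRegularBraiding For) {L : C} (F : L ⊗ L ⟶ L ⊗ L)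
    (hF : IsMultiplicativeUnitary F) :
    (star '' (braidedC For F : Set (For.obj L →L[ℂ] For.obj L)) = braidedC For F →
      IsCStarSubalgebra (hatA For F)) ∧
    (IsSemiRegular For F →
      star '' (braidedC For F : Set (For.obj L →L[ℂ] For.obj L)) = braidedC For F ∧
        IsCStarSubalgebra (hatA For F)) := by
  have h := braidedPentagon_unitaryOp hFor (hc.unitary L L) hF
  have hC := braidedC_eq hFor (hc.unitary L L) hF.unitary
  have main (hS : ∀ x ∈ braidedC For F, star x ∈ braidedC For F) :
      IsCStarSubalgebra (hatA For F) :=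
    h.isCStarSubalgebra (hc.compact_mem L L) (by rwa [hC] at hS)
  refine ⟨fun hS => main fun x hx => ?_, fun hK => ?_⟩
  · rw [← SetLike.mem_coe, ← hS]
    exact Set.mem_image_of_mem star hx
  · have hstar (x) (hx : x ∈ braidedC For F) : star x ∈ braidedC For F := by
      rw [hC] at hx ⊢
      refine h.star_mem_of_compact (fun T hT => ?_) hx
      rw [← hC]; exact hK T hT
    refine ⟨Set.Subset.antisymm ?_ fun x hx => ⟨star x, hstar x hx, star_star x⟩, main hstar⟩
    rintro _ ⟨x, hx, rfl⟩
    exact hstar x hx
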